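/- Let $Q=Q(d,d_0)$ be any of the compact connected two-point homogeneous spaces: the sphere $S^d$, $d\ge 1$ (with $d_0=d$); the projective spaces $\mathbb{F}P^n$, $n\ge 2$, over $\mathbb{F}=\mathbb{R},\mathbb{C},\mathbb{H}$ (with $d_0=\dim_{\mathbb R}\mathbb F=1,2,4$ and $d=nd_0$); or the octonionic projective plane $\mathbb{O}P^2$ (with $d_0=8$, $d=16$). Let $\mu$ be the invariant Riemannian measure on $Q$ normalized by $\mu(Q)=1$, and let $\theta$ be the invariant Riemannian distance on $Q$ normalized to have diameter $\pi$. Explicitly, $\cos\theta(x_1,x_2)=(x_1,x_2)$ on the unit sphere $S^d\subset\mathbb{R}^{d+1}$; and, realizing $\mathbb{F}P^n$ as the set of Hermitian $(n+1)\times(n+1)$ matrices $\Pi$ over $\mathbb{F}$ with $\Pi^2=\Pi$ and $\operatorname{Tr}\Pi=1$, with the inner product $\langle \Pi_1,\Pi_2\rangle=\operatorname{Re}\operatorname{Tr}(\Pi_1\Pi_2)$, one has $\cos\frac12\theta(\Pi_1,\Pi_2)=\langle\Pi_1,\Pi_2\rangle^{1/2}$, $0\le\theta\le\pi$. Let $B_r(y)=\{x\in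 Q:\theta(x,y)<r\}$, and define the chordal metric and the symmetric difference metric with the weight $\eta^{\natural}(r)=\sin r$, $r\in[0,\pi]$, by $$\tau(x_1,x_2)=\sin\tfrac12\theta(x_1,x_2),\qquad \theta^{\Delta}(\eta^{\natural},x_1,x_2)=\int_0^{\pi}\tfrac12\,\mu\big(B_r(x_1)\,\Delta\,B_r(x_2)\big)\sin r\,dr,$$ where $B_r(x_1)\,\Delta\,B_r(x_2)$ is the symmetric difference of sets. For a metric $\rho$ on $Q$ write $\langle\rho\rangle=\iint_{Q\times Q}\rho(y_1,y_2)\,d\mu(y_1)\,d\mu(y_2)$ and $\operatorname{diam}(Q,\rho)=\sup_{x_1,x_2\in Q}\rho(x_1,x_2)$. **Theorem 2.1.** For every such space $Q$ there is a constant $\gamma(Q)$ such that $$\tau(x_1,x_2)=\gamma(Q)\,\theta^{\Delta}(\eta^{\natural},x_1,x_2)\quad\text{for all }x_1,x_2\in Q,$$ and $$\gamma(Q)=\frac{\langle\tau\rangle}{\langle\theta^{\Delta}(\eta^{\natural})\rangle}=\frac{\operatorname{diam}(Q,\tau)}{\operatorname{diam}(Q,\theta^{\Delta}(\eta^{\natural}))}.$$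 -/

import Mathlib

open MeasureTheory Quaternion

noncomputable section

/-! Octonions, as pairs of quaternions with the Cayley-Dickson product. -/

/-- The real vector space of the octonions, with the Euclidean norm of `ℝ⁸`. -/
def Octonion : Type := WithLp 2 (ℍ[ℝ] × ℍ[ℝ])

namespace Octonion

instance : NormedAddCommGroup Octonion :=
  inferInstanceAs (NormedAddCommGroup (WithLp 2 (ℍ[ℝ] × ℍ[ℝ])))

instance : InnerProductSpace ℝ Octonion :=
  inferInstanceAs (InnerProductSpace ℝ (WithLp 2 (ℍ[ℝ] × ℍ[ℝ])))

/-- The octonion with quaternionic components `a` and `b`. -/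
def mk (a b : ℍ[ℝ]) : Octonion := WithLp.toLp 2 (a, b)

/-- First quaternionic component. -/
def fst (x : Octonion) : ℍ[ℝ] := (WithLp.ofLp (p := 2) (V := ℍ[ℝ] × ℍ[ℝ]) x).1

/-- Second quaternionic component. -/
def snd (x : Octonion) : ℍ[ℝ] := (WithLp.ofLp (p := 2) (V := ℍ[ℝ] × ℍ[ℝ]) x).2

instance : One Octonion := ⟨mk 1 0⟩

/-- Conjugation. -/
instance : Star Octonion := ⟨fun x => mk (star x.fst) (-x.snd)⟩

/-- The product `(a, b) (c, d) = (a c - d b̄, ā d + c b)`. -/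
instance : Mul Octonion :=
  ⟨fun x y => mk (x.fst * y.fst - y.snd * star x.snd) (star x.fst * y.snd + y.fst * x.snd)⟩

end Octonion

/-! Projective spaces over `F = ℝ, ℂ, ℍ` and the octonionic projective plane, in the model
by Hermitian idempotent matrices of trace one. -/

section Projective

variable (F : Type) [NormedAddCommGroup F] [InnerProductSpace ℝ F] [Mul F] [One F] [Star F]

/-- The projective space `F Pⁿ`: all `(n+1) × (n+1)` matrices `P` over `F` with
`P* = P`, `P² = P` and `Tr P = 1`. The ambient space of all matrices carries the Euclidean norm
`‖A‖² = ∑ |a_ij|²` and the inner product `⟨A, B⟩ = Re ∑ a_ij conj(b_ij) = Re Tr(A B*)`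
(which is `Re Tr(A B)` for Hermitian matrices). -/
def ProjectiveSpace (n : ℕ) : Type :=
  {P : PiLp 2 (fun _ : Fin (n + 1) × Fin (n + 1) => F) //
    (∀ i j, P (i, j) = star (P (j, i))) ∧
    (∀ i j, ∑ k, P (i, k) * P (k, j) = P (i, j)) ∧
    ∑ i, P (i, i) = 1}

/-- The metric induced by the Euclidean norm of the ambient space of matrices. -/
instance (n : ℕ) : MetricSpace (ProjectiveSpace F n) :=
  inferInstanceAs (MetricSpace (Subtype _))

instance (n : ℕ) : MeasurableSpace (ProjectiveSpace F n) := borel _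

instance (n : ℕ) : BorelSpace (ProjectiveSpace F n) := ⟨rfl⟩

/-- The geodesic distance on `F Pⁿ` normalized to have diameter `π`:
`cos (θ/2) = ⟨P, R⟩ ^ (1/2)`, with `0 ≤ θ ≤ π`. If `P = a a*` and `R = b b*` are the projectors on
the lines spanned by unit vectors `a, b`, then `⟨P, R⟩ ^ (1/2) = |(a, b)|`, so that `θ/2` is the
angle between the two lines. -/
def projectiveDist (n : ℕ) (P R : ProjectiveSpace F n) : ℝ :=
  2 * Real.arccos (Real.sqrt (inner ℝ P.1 R.1))

end Projective

/-! Spheres. -/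

/-- The unit sphere `S^d` in `ℝ^(d+1)`. -/
abbrev UnitSphere (d : ℕ) : Type := Metric.sphere (0 : EuclideanSpace ℝ (Fin (d + 1))) 1

/-- The geodesic distance on the unit sphere: `cos θ = (x, y)`, with `0 ≤ θ ≤ π`. -/
def sphereDist (d : ℕ) (x y : UnitSphere d) : ℝ :=
  Real.arccos (inner ℝ (x : EuclideanSpace ℝ (Fin (d + 1))) (y : EuclideanSpace ℝ (Fin (d + 1))))

/-- The `d`-dimensional Hausdorff measure, normalized to have total mass one. On a compact
`d`-dimensional submanifold of a Euclidean space with the induced metric, the Hausdorff measure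
is (up to a constant factor) the Riemannian volume, so this is the normalized Riemannian measure. -/
def normalizedVolume (X : Type) [EMetricSpace X] [MeasurableSpace X] [BorelSpace X] (d : ℕ) :
    Measure X :=
  (Measure.hausdorffMeasure (X := X) d Set.univ)⁻¹ • Measure.hausdorffMeasure (X := X) d

/-! The list of compact connected two-point homogeneous spaces. -/

/-- Labels for the compact connected two-point homogeneous spaces. -/
inductive SpaceLabel : Type
  | sphere (d : ℕ) (hd : 1 ≤ d) : SpaceLabel
  | realProjective (n : ℕ) (hn : 2 ≤ n) : SpaceLabel
  | complexProjective (n : ℕ) (hn : 2 ≤ n) : SpaceLabel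
  | quaternionicProjective (n : ℕ) (hn : 2 ≤ n) : SpaceLabel
  | octonionicPlane : SpaceLabel

/-- A set with a sigma-algebra, a distance function and a measure (only used for the concrete
spaces `twoPointSpace` below). -/
structure MetricMeasureData where
  carrier : Type
  measurableSpace : MeasurableSpace carrier
  θ : carrier → carrier → ℝ
  μ : @Measure carrier measurableSpace

instance (Q : MetricMeasureData) : MeasurableSpace Q.carrier := Q.measurableSpace

/-- The space `Q(d, d₀)`, with its normalized geodesic distance and Riemannian measure; here
`(d, d₀)` is `(d, d)`, `(n, 1)`, `(2n, 2)`, `(4n, 4)` and `(16, 8)` in the five cases. -/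
def twoPointSpace : SpaceLabel → MetricMeasureData
  | .sphere d _ =>
    ⟨UnitSphere d, inferInstance, sphereDist d, normalizedVolume (UnitSphere d) d⟩
  | .realProjective n _ =>
    ⟨ProjectiveSpace ℝ n, inferInstance, projectiveDist ℝ n,
      normalizedVolume (ProjectiveSpace ℝ n) n⟩
  | .complexProjective n _ =>
    ⟨ProjectiveSpace ℂ n, inferInstance, projectiveDist ℂ n,
      normalizedVolume (ProjectiveSpace ℂ n) (2 * n)⟩
  | .quaternionicProjective n _ =>
    ⟨ProjectiveSpace ℍ[ℝ] n, inferInstance, projectiveDist ℍ[ℝ] n,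
      normalizedVolume (ProjectiveSpace ℍ[ℝ] n) (4 * n)⟩
  | .octonionicPlane =>
    ⟨ProjectiveSpace Octonion 2, inferInstance, projectiveDist Octonion 2,
      normalizedVolume (ProjectiveSpace Octonion 2) 16⟩

namespace MetricMeasureData

variable (Q : MetricMeasureData)

/-- The open ball `B_r(y) = {x : θ(x, y) < r}`. -/
def ball (r : ℝ) (y : Q.carrier) : Set Q.carrier := {x | Q.θ x y < r}

/-- `θ^Δ_r(y₁, y₂) = (1/2) μ(B_r(y₁) Δ B_r(y₂))`. -/
def symmDiffMetricAt (r : ℝ) (y₁ y₂ : Q.carrier) : ℝ :=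
  (1 / 2) * Q.μ.real (symmDiff (Q.ball r y₁) (Q.ball r y₂))

/-- The symmetric difference metric `θ^Δ(η, y₁, y₂) = ∫₀^π θ^Δ_r(y₁, y₂) η(r) dr`. -/
def symmDiffMetric (η : ℝ → ℝ) (y₁ y₂ : Q.carrier) : ℝ :=
  ∫ r in (0 : ℝ)..Real.pi, Q.symmDiffMetricAt r y₁ y₂ * η r

/-- The chordal metric `τ = sin (θ/2)`. -/
def chordalMetric (x₁ x₂ : Q.carrier) : ℝ := Real.sin (Q.θ x₁ x₂ / 2)

/-- The average value `⟨ρ⟩ = ∬ ρ dμ dμ`. -/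
def average (ρ : Q.carrier → Q.carrier → ℝ) : ℝ := ∫ y₁, ∫ y₂, ρ y₁ y₂ ∂Q.μ ∂Q.μ

/-- The diameter `sup ρ(x₁, x₂)` with respect to `ρ`. -/
def diam (ρ : Q.carrier → Q.carrier → ℝ) : ℝ := ⨆ p : Q.carrier × Q.carrier, ρ p.1 p.2

end MetricMeasureData

end

open MeasureTheory Quaternion

noncomputable section

/-! Since `sin r` is the derivative of `-cos r`, Fubini in `(r, z)` turns the symmetric difference
metric into `(1/2) ∫ |cos θ(z, x) - cos θ(z, y)| dμ(z)`. Each space embeds isometrically, by a map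
`ι`, into the unit sphere of a Euclidean space so that `cos θ(x, z)` is an affine function of `⟨ι x,
ι z⟩`. The integrand is then a constant times `|⟨ι x - ι y, ι z⟩|`. If measure-preserving isometries
bring every difference `ι x - ι y` to `‖ι x - ι y‖ • D` for one fixed vector `D`, the integral is
`‖ι x - ι y‖` times a constant independent of `x` and `y`. The chordal metric is also a multiple of
`‖ι x - ι y‖`, so the two metrics are proportional, and the formulas for the constant follow by
averaging and by taking suprema (`chordalEqSymmDiff_of_homogeneous`).

It remains to find the isometries and to check that the Hausdorff measure is positive and finite. On
spheres, reflections suffice. On projective spaces, an automorphism first makes two projectors real;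
then `v vᵀ - w wᵀ` is half the symmetrized product of the orthogonal vectors `v - w` and `v + w`,
which a real rotation takes to coordinate axes (`exists_map_sub_eq_smul`).

Making a projector real is a diagonal unitary conjugation when `F` is associative. For octonions it
combines real rotations with the maps `a ↦ u a`, `b ↦ b u`, `c ↦ ū c ū` of the off-diagonal entries,
which respect squares of Hermitian matrices by the Moufang identities (`matSq_triality`). The other
facts on projectors use only the axioms of `CompositionAlgebra`, so that one argument serves all
four algebras. -/

theorem integral_sin_of_xor {a b : ℝ} (ha : a ∈ Set.Icc 0 Real.pi) (hb : b ∈ Set.Icc 0 Real.pi) :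
    ∫ r in Set.Ioc 0 Real.pi, (if (a < r ↔ b < r) then 0 else Real.sin r)
      = |Real.cos a - Real.cos b| := by
  wlog hab : a ≤ b generalizing a b
  · rw [abs_sub_comm, ← this hb ha (le_of_not_ge hab)]
    simp only [iff_comm]
  -- For `a ≤ b` the two conditions disagree exactly when `a < r ≤ b`.
  have h : (fun r => if (a < r ↔ b < r) then 0 else Real.sin r)
      = (Set.Ioc a b).indicator Real.sin := by
    ext r
    by_cases h1 : a < r <;> by_cases h2 : b < r
    · simp [h1, h2, Set.indicator, h2.not_ge]
    · simp [h1, h2, Set.indicator, not_lt.mp h2]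
    · exact absurd (hab.trans_lt h2) h1
    · simp [h1, h2, Set.indicator]
  rw [h, setIntegral_indicator measurableSet_Ioc]
  have hs : Set.Ioc 0 Real.pi ∩ Set.Ioc a b = Set.Ioc a b :=
    Set.inter_eq_right.mpr (Set.Ioc_subset_Ioc ha.1 hb.2)
  rw [hs, ← intervalIntegral.integral_of_le hab, integral_sin, abs_of_nonneg]
  exact sub_nonneg.mpr (Real.cos_le_cos_of_nonneg_of_le_pi ha.1 hb.2 hab)

/-- Writing the measure of the symmetric difference as an integral of an indicator and exchanging
the integrals leaves, for each `z`, the integral of `sin` between `θ z x` and `θ z y`. -/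
theorem symmDiffMetric_sin_eq_integral {X : Type} [MeasurableSpace X] (θ : X → X → ℝ)
    (μ : Measure X) [IsFiniteMeasure μ] (hm : ∀ x, Measurable fun z => θ z x)
    (hr : ∀ x z, θ z x ∈ Set.Icc 0 Real.pi) (x y : X) :
    (MetricMeasureData.mk X ‹_› θ μ).symmDiffMetric Real.sin x y
      = (1 / 2) * ∫ z, |Real.cos (θ z x) - Real.cos (θ z y)| ∂μ := by
  classical
  set f : ℝ → X → ℝ := fun r z => if (θ z x < r ↔ θ z y < r) then 0 else Real.sin r with hf
  have hA : ∀ x, MeasurableSet {p : ℝ × X | θ p.2 x < p.1} := fun x =>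
    measurableSet_lt ((hm x).comp measurable_snd) measurable_fst
  have hfm : Measurable (Function.uncurry f) := by
    refine Measurable.ite ?_ measurable_const (Real.measurable_sin.comp measurable_fst)
    have := ((hA x).inter (hA y)).union ((hA x).compl.inter (hA y).compl)
    convert this using 1
    ext p
    simp only [Set.mem_ofPred_eq, Set.mem_union, Set.mem_inter_iff, Set.mem_compl_iff]
    tauto
  have hint : Integrable (Function.uncurry f) ((volume.restrict (Set.Ioc 0 Real.pi)).prod μ) := by
    refine Integrable.of_bound hfm.aestronglyMeasurable 1 (Filter.Eventually.of_forall fun p => ?_)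
    simp only [Function.uncurry, hf]
    split_ifs
    · simp
    · exact Real.abs_sin_le_one _
  have hS : ∀ r, MeasurableSet {z | θ z x < r} ∧ MeasurableSet {z | θ z y < r} := fun r =>
    ⟨measurableSet_lt (hm x) measurable_const, measurableSet_lt (hm y) measurable_const⟩
  have key : ∀ r, (MetricMeasureData.mk X ‹_› θ μ).symmDiffMetricAt r x y * Real.sin r
      = (1 / 2) * ∫ z, f r z ∂μ := by
    intro r
    unfold MetricMeasureData.symmDiffMetricAt MetricMeasureData.ball
    rw [mul_assoc]
    congr 1
    have : f r = (symmDiff {z | θ z x < r} {z | θ z y < r}).indicator fun _ => Real.sin r := by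
      ext z
      simp only [hf, Set.indicator, Set.mem_symmDiff, Set.mem_ofPred_eq]
      by_cases h1 : θ z x < r <;> by_cases h2 : θ z y < r <;> simp [h1, h2]
    rw [this, integral_indicator_const _ ((hS r).1.symmDiff (hS r).2), smul_eq_mul]
  unfold MetricMeasureData.symmDiffMetric
  rw [intervalIntegral.integral_of_le Real.pi_pos.le]
  simp_rw [key]
  rw [integral_const_mul, integral_integral_swap hint]
  congr 1
  refine integral_congr_ae (Filter.Eventually.of_forall fun z => ?_)
  exact integral_sin_of_xor (hr x z) (hr y z)

/-- The conclusion of the comparison of the chordal and symmetric difference metrics. -/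
def MetricMeasureData.ChordalEqSymmDiff (Q : MetricMeasureData) : Prop :=
  ∃ γ : ℝ,
    (∀ x₁ x₂ : Q.carrier, Q.chordalMetric x₁ x₂ = γ * Q.symmDiffMetric Real.sin x₁ x₂) ∧
    γ = Q.average Q.chordalMetric / Q.average (Q.symmDiffMetric Real.sin) ∧
    γ = Q.diam Q.chordalMetric / Q.diam (Q.symmDiffMetric Real.sin)

/-! ### Proportionality of the two metrics under homogeneity -/

/-- A measure without atoms gives full mass to the complement of `x`, where the integrand is
positive. This keeps the quotient of the averages from being `0 / 0`. -/
theorem average_norm_sub_pos {V X : Type} [NormedAddCommGroup V] [MetricSpace X]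
    [MeasurableSpace X] [BorelSpace X] [SecondCountableTopology X] [Nontrivial X] {ι : X → V} (hι
      : Isometry ι)
    (hnorm : ∀ x, ‖ι x‖ = 1) {μ : Measure X} [IsProbabilityMeasure μ] [NullSingletonClass μ] :
    0 < ∫ x, ∫ y, ‖ι x - ι y‖ ∂μ ∂μ := by
  have hcont : Continuous fun p : X × X => ‖ι p.1 - ι p.2‖ :=
    ((hι.continuous.comp continuous_fst).sub (hι.continuous.comp continuous_snd)).norm
  have hb : ∀ x y, ‖ι x - ι y‖ ≤ 2 := fun x y => by
    have := norm_sub_le (ι x) (ι y)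
    rw [hnorm, hnorm] at this
    linarith
  have hint : ∀ x, Integrable (fun y => ‖ι x - ι y‖) μ := fun x =>
    Integrable.of_bound (hcont.comp (Continuous.prodMk_right x)).aestronglyMeasurable 2
      (Filter.Eventually.of_forall fun y => by simpa using hb x y)
  have hpos : ∀ x, 0 < ∫ y, ‖ι x - ι y‖ ∂μ := by
    intro x
    rw [integral_pos_iff_support_of_nonneg (fun _ => norm_nonneg _) (hint x)]
    have : Function.support (fun y => ‖ι x - ι y‖) = {x}ᶜ := by
      ext y
      simp [sub_eq_zero, hι.injective.eq_iff, eq_comm]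
    rw [this, prob_compl_eq_one_sub (measurableSet_singleton x)]
    simp
  have hI : Integrable (fun x => ∫ y, ‖ι x - ι y‖ ∂μ) μ := by
    refine Integrable.of_bound
      (hcont.stronglyMeasurable.integral_prod_right').aestronglyMeasurable 2
      (Filter.Eventually.of_forall fun x => ?_)
    rw [Real.norm_eq_abs, abs_of_pos (hpos x)]
    calc ∫ y, ‖ι x - ι y‖ ∂μ ≤ ∫ _, (2 : ℝ) ∂μ :=
          integral_mono (hint x) (integrable_const _) (hb x)
      _ = 2 := by simp
  rw [integral_pos_iff_support_of_nonneg (fun x => (hpos x).le) hI]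
  have : Function.support (fun x => ∫ y, ‖ι x - ι y‖ ∂μ) = Set.univ := by
    ext x
    simpa using (hpos x).ne'
  rw [this]
  simp

section

variable {V X : Type} [NormedAddCommGroup V] [InnerProductSpace ℝ V] [MetricSpace X]
  [MeasurableSpace X] [BorelSpace X] [SecondCountableTopology X]

/-- If the integral vanished, homogeneity would make `ι z` orthogonal to each difference `ι x - ι y`
for almost every `z`. A countable dense set of pairs and continuity give one `z` that works for all
pairs. Taking `x = z` forces `⟨ι y, ι z⟩ = 1`, hence `y = z`, for every `y`. -/
theorem integral_abs_inner_ne_zero [Nontrivial X] {ι : X → V} (hι : Isometry ι)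
    (hnorm : ∀ x, ‖ι x‖ = 1) {D : V} {μ : Measure X} [IsProbabilityMeasure μ]
    (hhom : ∀ x y, ∃ g : X ≃ᵢ X, MeasurePreserving g μ μ ∧
      ∀ z, inner ℝ (ι x - ι y) (ι (g z)) = ‖ι x - ι y‖ * inner ℝ D (ι z)) :
    ∫ z, |inner ℝ D (ι z)| ∂μ ≠ 0 := by
  intro h0
  have hcont : Continuous fun z => |inner ℝ D (ι z)| :=
    (continuous_const.inner hι.continuous).abs
  have hint : Integrable (fun z => |inner ℝ D (ι z)|) μ := by
    refine Integrable.of_bound hcont.aestronglyMeasurable ‖D‖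
      (Filter.Eventually.of_forall fun z => ?_)
    rw [Real.norm_eq_abs, abs_abs]
    simpa [hnorm] using abs_real_inner_le_norm D (ι z)
  rw [integral_eq_zero_iff_of_nonneg (fun _ => abs_nonneg _) hint] at h0
  have hpair : ∀ x y, ∀ᵐ z ∂μ, inner ℝ (ι x - ι y) (ι z) = 0 := by
    intro x y
    obtain ⟨g, hg, hz⟩ := hhom x y
    have hg' : MeasurePreserving g.symm μ μ := hg.symm g.toHomeomorph.toMeasurableEquiv
    filter_upwards [hg'.quasiMeasurePreserving.ae h0] with z h
    have h1 := hz (g.symm z)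
    rw [g.apply_symm_apply] at h1
    rw [h1, abs_eq_zero.mp h, mul_zero]
  let s := TopologicalSpace.denseSeq X
  have hall : ∀ᵐ z ∂μ, ∀ m k : ℕ, inner ℝ (ι (s m) - ι (s k)) (ι z) = 0 := by
    rw [ae_all_iff]; intro m; rw [ae_all_iff]; intro k; exact hpair _ _
  obtain ⟨z, hz⟩ := hall.exists
  have hd := TopologicalSpace.denseRange_denseSeq X
  have hfull : ∀ p : X × X, inner ℝ (ι p.1 - ι p.2) (ι z) = 0 := by
    have hc : IsClosed {p : X × X | inner ℝ (ι p.1 - ι p.2) (ι z) = 0} := by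
      refine isClosed_eq (Continuous.inner ?_ continuous_const) continuous_const
      exact (hι.continuous.comp continuous_fst).sub (hι.continuous.comp continuous_snd)
    intro p
    refine (hd.prodMap hd).induction_on (p := fun p => inner ℝ (ι p.1 - ι p.2) (ι z) = 0) p hc ?_
    rintro ⟨m, k⟩
    exact hz m k
  obtain ⟨y, hy⟩ := exists_ne z
  have h1 := hfull (z, y)
  rw [inner_sub_left, real_inner_self_eq_norm_sq, hnorm, sub_eq_zero] at h1
  have h2 : ι y = ι z := by
    rw [← inner_eq_one_iff_of_norm_eq_one (𝕜 := ℝ) (hnorm y) (hnorm z)]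
    rw [← h1]; norm_num
  exact hy (hι.injective h2)

/-- Both metrics are positive multiples of `‖ι x - ι y‖`, with factors `κ` and `α c / 2`, where `c`
is the mean of `|⟨D, ι z⟩|`. The shift `β` cancels in differences of cosines. -/
theorem chordalEqSymmDiff_of_homogeneous [Nontrivial X] {ι : X → V} (hι : Isometry ι)
    (hnorm : ∀ x, ‖ι x‖ = 1) (D : V) {μ : Measure X} [IsProbabilityMeasure μ] [NullSingletonClass μ]
    (hhom : ∀ x y, ∃ g : X ≃ᵢ X, MeasurePreserving g μ μ ∧
      ∀ z, inner ℝ (ι x - ι y) (ι (g z)) = ‖ι x - ι y‖ * inner ℝ D (ι z))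
    {θ : X → X → ℝ} {α β κ : ℝ} (hα : 0 < α) (hκ : 0 < κ)
    (hθ : ∀ x, Continuous fun z => θ z x) (hr : ∀ x z, θ z x ∈ Set.Icc 0 Real.pi)
    (hcos : ∀ x z, Real.cos (θ z x) = α * inner ℝ (ι x) (ι z) + β)
    (hsin : ∀ x y, Real.sin (θ x y / 2) = κ * ‖ι x - ι y‖) :
    (MetricMeasureData.mk X ‹_› θ μ).ChordalEqSymmDiff := by
  set Q := MetricMeasureData.mk X ‹_› θ μ
  set c := ∫ z, |inner ℝ D (ι z)| ∂μ with hc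
  have hc0 : 0 < c := lt_of_le_of_ne (integral_nonneg fun _ => abs_nonneg _)
    (Ne.symm (integral_abs_inner_ne_zero hι hnorm hhom))
  have hsd : ∀ x y : X, Q.symmDiffMetric Real.sin x y = (α * c / 2) * ‖ι x - ι y‖ := by
    intro x y
    refine (symmDiffMetric_sin_eq_integral θ μ (fun x => (hθ x).measurable) hr x y).trans ?_
    obtain ⟨g, hg, hz⟩ := hhom x y
    have h1 : ∀ z, |Real.cos (θ z x) - Real.cos (θ z y)| = α * |inner ℝ (ι x - ι y) (ι z)| := by
      intro z
      rw [hcos, hcos, ← abs_of_pos hα, ← abs_mul, abs_of_pos hα, inner_sub_left]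
      congr 1
      ring
    simp_rw [h1]
    rw [integral_const_mul]
    have h2 : ∫ z, |inner ℝ (ι x - ι y) (ι z)| ∂μ
        = ∫ z, |inner ℝ (ι x - ι y) (ι (g z))| ∂μ :=
      (hg.integral_comp g.toHomeomorph.measurableEmbedding
        (fun z => |inner ℝ (ι x - ι y) (ι z)|)).symm
    rw [h2]
    simp_rw [hz, abs_mul, abs_norm]
    rw [integral_const_mul]
    ring
  have hτ : ∀ x y : X, Q.chordalMetric x y = κ * ‖ι x - ι y‖ := hsin
  have hαc : α * c / 2 ≠ 0 := by positivity
  have hmul : ∀ x y : X, Q.chordalMetric x y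
      = (κ / (α * c / 2)) * Q.symmDiffMetric Real.sin x y := by
    intro x y
    rw [hτ, hsd, ← mul_assoc, div_mul_cancel₀ _ hαc]
  refine ⟨κ / (α * c / 2), hmul, ?_, ?_⟩
  · have hav : Q.average (Q.symmDiffMetric Real.sin)
        = (α * c / 2) * ∫ x, ∫ y, ‖ι x - ι y‖ ∂μ ∂μ := by
      unfold MetricMeasureData.average
      change ∫ x, ∫ y, Q.symmDiffMetric Real.sin x y ∂μ ∂μ = _
      simp_rw [hsd, integral_const_mul]
    have hav' : Q.average Q.chordalMetric = κ * ∫ x, ∫ y, ‖ι x - ι y‖ ∂μ ∂μ := by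
      unfold MetricMeasureData.average
      change ∫ x, ∫ y, Q.chordalMetric x y ∂μ ∂μ = _
      simp_rw [hτ, integral_const_mul]
    rw [hav, hav', mul_div_mul_right _ _ (average_norm_sub_pos hι hnorm).ne']
  · have hd : ∀ k : ℝ, 0 ≤ k → ∀ ρ : X → X → ℝ, (∀ x y, ρ x y = k * ‖ι x - ι y‖) →
        Q.diam ρ = k * ⨆ p : X × X, ‖ι p.1 - ι p.2‖ := by
      intro k hk ρ hρ
      rw [Real.mul_iSup_of_nonneg hk]
      exact iSup_congr fun p => hρ p.1 p.2
    rw [hd κ hκ.le _ hτ, hd (α * c / 2) (by positivity) _ hsd, mul_div_mul_right]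
    -- The supremum cancelled from the quotient is nonzero: distinct points have positive distance,
    -- and distances between unit vectors are at most `2`.
    obtain ⟨x, y, hxy⟩ := exists_pair_ne X
    refine ne_of_gt (lt_of_lt_of_le ?_ (le_ciSup (f := fun p : X × X => ‖ι p.1 - ι p.2‖)
      ⟨2, ?_⟩ (x, y)))
    · simpa [sub_eq_zero, hι.injective.eq_iff] using hxy
    · rintro _ ⟨p, rfl⟩
      have := norm_sub_le (ι p.1) (ι p.2)
      rw [hnorm, hnorm] at this
      dsimp only
      linarith

end

/-! ### Positivity, finiteness and invariance of the Hausdorff measure -/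

open MeasureTheory.Measure in
-- By compactness it suffices to work near a point. There `f` is Lipschitz, and on `E` the Hausdorff
-- measure of dimension `finrank ℝ E` is locally finite.
theorem hausdorffMeasure_image_lt_top {E V : Type*} [NormedAddCommGroup E] [NormedSpace ℝ E]
    [FiniteDimensional ℝ E] [EMetricSpace V] [MeasurableSpace V] [BorelSpace V] {d : ℕ}
    (hd : Module.finrank ℝ E = d) {f : E → V} (hf : LocallyLipschitz f) {K : Set E}
    (hK : IsCompact K) : μH[(d : ℝ)] (f '' K) < ⊤ := by
  borelize E
  subst hd
  refine hK.induction_on (p := fun s => μH[(Module.finrank ℝ E : ℝ)] (f '' s) < ⊤) ?_ ?_ ?_ ?_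
  · simp
  · intro s t hst ht
    exact (measure_mono (Set.image_mono hst)).trans_lt ht
  · intro s t hs ht
    rw [Set.image_union]
    exact measure_union_lt_top hs ht
  · intro x _
    obtain ⟨C, t, ht, hC⟩ := hf x
    obtain ⟨u, hu, hufin⟩ := (μH[(Module.finrank ℝ E : ℝ)] : Measure E).finiteAt_nhds x
    refine ⟨t ∩ u, mem_nhdsWithin_of_mem_nhds (Filter.inter_mem ht hu), ?_⟩
    refine ((hC.mono Set.inter_subset_left).hausdorffMeasure_image_le (by positivity)).trans_lt ?_
    refine ENNReal.mul_lt_top (ENNReal.rpow_lt_top_of_nonneg (by positivity) (by simp)) ?_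
    exact (measure_mono Set.inter_subset_right).trans_lt hufin

open MeasureTheory.Measure in
-- A 1-Lipschitz map does not increase Hausdorff measure, and a ball in `E` has positive measure.
theorem hausdorffMeasure_pos_of_ball_subset_image {E V : Type*} [NormedAddCommGroup E]
    [NormedSpace ℝ E] [FiniteDimensional ℝ E] [EMetricSpace V] [MeasurableSpace V]
    [BorelSpace V] {d : ℕ} (hd : Module.finrank ℝ E = d) {g : V → E} (hg : LipschitzWith 1 g)
    {s : Set V} {r : ℝ} (hr : 0 < r) (hs : Metric.ball 0 r ⊆ g '' s) : 0 < μH[(d : ℝ)] s := by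
  borelize E
  subst hd
  have h1 : 0 < (μH[(Module.finrank ℝ E : ℝ)] : Measure E) (Metric.ball 0 r) :=
    Metric.measure_ball_pos _ _ hr
  have h2 := hg.hausdorffMeasure_image_le (d := (Module.finrank ℝ E : ℝ)) (by positivity) s
  simp only [ENNReal.coe_one, ENNReal.one_rpow, one_mul] at h2
  exact h1.trans_le ((measure_mono hs).trans h2)

section

variable {X : Type} [MetricSpace X] [MeasurableSpace X] [BorelSpace X] {d : ℕ}

open MeasureTheory.Measure in
theorem isProbabilityMeasure_normalizedVolume (h0 : 0 < (μH[(d : ℝ)] : Measure X) Set.univ)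
    (h1 : (μH[(d : ℝ)] : Measure X) Set.univ < ⊤) :
    IsProbabilityMeasure (normalizedVolume X d) :=
  ⟨by
    rw [normalizedVolume, Measure.smul_apply, smul_eq_mul]
    exact ENNReal.inv_mul_cancel h0.ne' h1.ne⟩

theorem nullSingletonClass_normalizedVolume (hd : 1 ≤ d) :
    NullSingletonClass (normalizedVolume X d) := by
  have : NullSingletonClass (Measure.hausdorffMeasure (d : ℝ) : Measure X) :=
    Measure.nullSingletonClass_hausdorff X (by exact_mod_cast hd)
  exact ⟨fun x => by simp [normalizedVolume, measure_singleton]⟩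

theorem measurePreserving_normalizedVolume (g : X ≃ᵢ X) :
    MeasurePreserving g (normalizedVolume X d) (normalizedVolume X d) :=
  (g.measurePreserving_hausdorffMeasure d).smul_measure _

end

theorem exists_linearIsometryEquiv_map_eq {E : Type} [NormedAddCommGroup E] [InnerProductSpace ℝ
  E] {v w : E} (h : ‖v‖ = ‖w‖) :
    ∃ g : E ≃ₗᵢ[ℝ] E, g v = w :=
  ⟨(ℝ ∙ (v - w))ᗮ.reflection, Submodule.reflection_sub h⟩

/-! ### Spheres -/

section Sphere

open Metric

variable {E : Type} [NormedAddCommGroup E] [InnerProductSpace ℝ E] [FiniteDimensional ℝ E]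

open MeasureTheory.Measure in
-- Stereographic projection from `v` is continuous on the closed half-sphere opposite to `v`, so the
-- half-sphere lies in the image of a compact set under the smooth inverse projection. Two opposite
-- half-spheres cover the sphere.
theorem hausdorffMeasure_sphere_lt_top [MeasurableSpace E] [BorelSpace E] {d : ℕ}
    (hd : Module.finrank ℝ E = d + 1) :
    (μH[(d : ℝ)] : Measure E) (sphere (0 : E) 1) < ⊤ := by
  have hhalf : ∀ v : E, ‖v‖ = 1 →
      (μH[(d : ℝ)] : Measure E) (sphere (0 : E) 1 ∩ {x | inner ℝ v x ≤ 0}) < ⊤ := by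
    intro v hv
    have hv0 : v ≠ 0 := fun h => by simp [h] at hv
    have : Fact (Module.finrank ℝ E = d + 1) := ⟨hd⟩
    set S := sphere (0 : E) 1 ∩ {x | inner ℝ v x ≤ 0} with hS
    have hSc : IsCompact S := (isCompact_sphere (0 : E) 1).inter_right
      (isClosed_le (continuous_const.inner continuous_id) continuous_const)
    have hK : IsCompact (stereoToFun v '' S) := by
      refine hSc.image_of_continuousOn (continuousOn_stereoToFun.mono ?_)
      rintro x ⟨-, hx⟩
      simp only [Set.mem_ofPred_eq, innerSL_apply_apply] at hx ⊢
      linarith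
    have hlip : LocallyLipschitz fun w : (ℝ ∙ v)ᗮ => stereoInvFunAux v (w : E) :=
      ((contDiff_stereoInvFunAux (v := v) (m := 1)).comp
        ((ℝ ∙ v)ᗮ.subtypeL.contDiff)).locallyLipschitz
    refine (measure_mono ?_).trans_lt (hausdorffMeasure_image_lt_top (d := d)
      (Submodule.finrank_orthogonal_span_singleton hv0) hlip hK)
    rintro x ⟨hx, hx'⟩
    refine ⟨_, ⟨x, ⟨hx, hx'⟩, rfl⟩, ?_⟩
    have hne : ((⟨x, hx⟩ : sphere (0 : E) 1) : E) ≠ v := by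
      rintro rfl
      simp only [Set.mem_ofPred_eq, real_inner_self_eq_norm_sq, hv] at hx'
      norm_num at hx'
    exact congrArg Subtype.val (stereo_left_inv hv hne)
  have : Nontrivial E := Module.nontrivial_of_finrank_pos (R := ℝ) (by omega)
  obtain ⟨v, hv⟩ := exists_norm_eq E zero_le_one
  refine (measure_mono ?_).trans_lt (measure_union_lt_top (hhalf v hv) (hhalf (-v) (by simpa)))
  intro x hx
  rcases le_total (inner ℝ v x) 0 with h | h
  · exact Or.inl ⟨hx, h⟩
  · exact Or.inr ⟨hx, by simpa using h⟩

open MeasureTheory.Measure in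
-- The orthogonal projection to a hyperplane is 1-Lipschitz, and its image of the sphere contains
-- the unit ball.
theorem hausdorffMeasure_sphere_pos [MeasurableSpace E] [BorelSpace E] {d : ℕ}
    (hd : Module.finrank ℝ E = d + 1) :
    0 < (μH[(d : ℝ)] : Measure E) (sphere (0 : E) 1) := by
  have : Nontrivial E := Module.nontrivial_of_finrank_pos (R := ℝ) (by omega)
  obtain ⟨v, hv⟩ := exists_norm_eq E zero_le_one
  have hv0 : v ≠ 0 := fun h => by simp [h] at hv
  have : Fact (Module.finrank ℝ E = d + 1) := ⟨hd⟩
  refine hausdorffMeasure_pos_of_ball_subset_image (d := d)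
    (Submodule.finrank_orthogonal_span_singleton hv0)
    (ℝ ∙ v)ᗮ.lipschitzWith_orthogonalProjectionOnto (r := 1) one_pos ?_
  intro y hy
  rw [mem_ball_zero_iff] at hy
  have hvy : inner ℝ (y : E) v = 0 :=
    Submodule.mem_orthogonal_singleton_iff_inner_left.mp y.2
  have hn : ‖(y : E)‖ = ‖y‖ := rfl
  refine ⟨y + √(1 - ‖y‖ ^ 2) • v, ?_, ?_⟩
  · rw [mem_sphere_zero_iff_norm, ← sq_eq_sq₀ (norm_nonneg _) zero_le_one,
      norm_add_sq_real, norm_smul, inner_smul_right, hvy, hv, hn, Real.norm_eq_abs, mul_one, sq_abs,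
      Real.sq_sqrt (by nlinarith [norm_nonneg y])]
    ring
  · rw [map_add, map_smul, Submodule.orthogonalProjectionOnto_mem_subspace_eq_self,
      Submodule.orthogonalProjectionOnto_orthogonal_apply_eq_zero
        (Submodule.mem_span_singleton_self v),
      smul_zero, add_zero]

/-- The restriction of a linear isometry to the unit sphere. -/
def sphereIsometryEquiv (g : E ≃ₗᵢ[ℝ] E) : sphere (0 : E) 1 ≃ᵢ sphere (0 : E) 1 where
  toFun x := ⟨g x, by simp⟩
  invFun x := ⟨g.symm x, by simp⟩
  left_inv x := by simp
  right_inv x := by simp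
  isometry_toFun := Isometry.of_dist_eq fun x y => g.isometry.dist_eq _ _

end Sphere

/-- The Euclidean space containing the unit sphere of dimension `d`. -/
abbrev SphereAmbient (d : ℕ) : Type := EuclideanSpace ℝ (Fin (d + 1))

theorem chordalEqSymmDiff_sphere (d : ℕ) (hd : 1 ≤ d) :
    (twoPointSpace (.sphere d hd)).ChordalEqSymmDiff := by
  have hfr : Module.finrank ℝ (SphereAmbient d) = d + 1 := by
    simp
  have hnorm : ∀ x : UnitSphere d, ‖(x : SphereAmbient d)‖ = 1 := fun x => by simp
  have hu : (Measure.hausdorffMeasure (d : ℝ) : Measure (UnitSphere d)) Set.univ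
      = (Measure.hausdorffMeasure (d : ℝ) : Measure (SphereAmbient d)) (Metric.sphere 0 1) := by
    rw [← isometry_subtype_coe.hausdorffMeasure_image (Or.inl (by positivity))]
    rw [Set.image_univ, Subtype.range_coe]
  have : IsProbabilityMeasure (normalizedVolume (UnitSphere d) d) :=
    isProbabilityMeasure_normalizedVolume (hu ▸ hausdorffMeasure_sphere_pos hfr)
      (hu ▸ hausdorffMeasure_sphere_lt_top hfr)
  have : NullSingletonClass (normalizedVolume (UnitSphere d) d) :=
    nullSingletonClass_normalizedVolume hd
  let e : SphereAmbient d := EuclideanSpace.single 0 1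
  have he : ‖e‖ = 1 := by simp [e]
  have : Nontrivial (UnitSphere d) := by
    refine ⟨⟨e, by simpa using he⟩, ⟨-e, by simpa using he⟩, fun h => ?_⟩
    have h1 : e = -e := congrArg Subtype.val h
    have h2 : (1 : ℝ) = -1 := by simpa [e] using congrArg (fun v : SphereAmbient d => v 0) h1
    norm_num at h2
  have hle : ∀ x z : UnitSphere d, |inner ℝ (x : SphereAmbient d) (z : SphereAmbient d)| ≤ 1 :=
    fun x z => by
    simpa using abs_real_inner_le_norm (x : SphereAmbient d) (z : SphereAmbient d)
  have hcos : ∀ x z, Real.cos (sphereDist d z x) = inner ℝ (x : SphereAmbient d) (z :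
    SphereAmbient d) := fun x z => by
    rw [sphereDist, Real.cos_arccos (abs_le.mp (hle _ _)).1 (abs_le.mp (hle _ _)).2,
      real_inner_comm]
  -- Here `cos θ = ⟨x, z⟩` and `‖x - y‖ = 2 sin (θ/2)`, which gives `α = 1`, `β = 0`, `κ = 1/2`.
  refine chordalEqSymmDiff_of_homogeneous (ι := fun x : UnitSphere d => (x : SphereAmbient d))
    isometry_subtype_coe hnorm e ?_ (α := 1) (β := 0) (κ := 1 / 2) one_pos (by norm_num) ?_ ?_ ?_ ?_
  · intro x y
    obtain ⟨g, hg⟩ := exists_linearIsometryEquiv_map_eq (E := SphereAmbient d)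
      (v := ‖(x : SphereAmbient d) - y‖ • e) (w := (x : SphereAmbient d) - y) (by simp [norm_smul,
        he])
    refine ⟨sphereIsometryEquiv g, measurePreserving_normalizedVolume _, fun z => ?_⟩
    change inner ℝ ((x : SphereAmbient d) - y) (g z) = _
    rw [← hg, g.inner_map_map, inner_smul_left, hg]
    simp
  · intro x
    unfold sphereDist
    fun_prop
  · intro x z
    exact ⟨Real.arccos_nonneg _, Real.arccos_le_pi _⟩
  · intro x z
    rw [hcos]
    ring
  · intro x y
    have h0 : 0 ≤ Real.sin (sphereDist d x y / 2) :=
      Real.sin_nonneg_of_nonneg_of_le_pi (div_nonneg (Real.arccos_nonneg _) zero_le_two)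
        (by have := Real.arccos_le_pi (inner ℝ (x : SphereAmbient d) (y : SphereAmbient d))
            have := Real.pi_pos
            unfold sphereDist
            linarith)
    rw [← sq_eq_sq₀ h0 (by positivity), Real.sin_sq_eq_half_sub, mul_pow,
      norm_sub_sq_real, hnorm, hnorm, mul_div_cancel₀ _ two_ne_zero, hcos, real_inner_comm]
    ring

/-! ### Composition algebras: the axioms, and the associative cases -/

/-- A real inner product space with an alternative unital product and a conjugation, for which
the norm is multiplicative. -/
class CompositionAlgebra (F : Type) [NormedAddCommGroup F] [InnerProductSpace ℝ F] [Mul F]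
    [One F] [Star F] : Prop where
  add_mul : ∀ x y z : F, (x + y) * z = x * z + y * z
  mul_add : ∀ x y z : F, x * (y + z) = x * y + x * z
  smul_mul : ∀ (r : ℝ) (x y : F), (r • x) * y = r • (x * y)
  mul_smul : ∀ (r : ℝ) (x y : F), x * (r • y) = r • (x * y)
  one_mul : ∀ x : F, 1 * x = x
  mul_one : ∀ x : F, x * 1 = x
  norm_one : ‖(1 : F)‖ = 1
  star_add : ∀ x y : F, star (x + y) = star x + star y
  star_smul : ∀ (r : ℝ) (x : F), star (r • x) = r • star x
  star_star : ∀ x : F, star (star x) = x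
  star_mul : ∀ x y : F, star (x * y) = star y * star x
  inner_mul_left : ∀ x y z : F, inner ℝ (x * y) z = inner ℝ y (star x * z)
  inner_mul_right : ∀ x y z : F, inner ℝ (x * y) z = inner ℝ x (z * star y)
  star_mul_mul : ∀ x y : F, star x * (x * y) = ‖x‖ ^ 2 • y
  mul_mul_star : ∀ x y : F, (y * x) * star x = ‖x‖ ^ 2 • y
  exists_smul_one : ∀ x : F, star x = x → ∃ r : ℝ, x = r • (1 : F)

instance : CompositionAlgebra ℝ where
  add_mul := add_mul
  mul_add := mul_add
  smul_mul := smul_mul_assoc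
  mul_smul := fun r x y => mul_smul_comm r x y
  one_mul := one_mul
  mul_one := mul_one
  norm_one := norm_one
  star_add := star_add
  star_smul := fun r x => by simp
  star_star := star_star
  star_mul := star_mul
  inner_mul_left := fun x y z => by simp; ring
  inner_mul_right := fun x y z => by simp; ring
  star_mul_mul := fun x y => by simp; ring
  mul_mul_star := fun x y => by simp; ring
  exists_smul_one := fun x _ => ⟨x, by simp⟩

instance : CompositionAlgebra ℂ where
  add_mul := add_mul
  mul_add := mul_add
  smul_mul := smul_mul_assoc
  mul_smul := fun r x y => mul_smul_comm r x y
  one_mul := one_mul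
  mul_one := mul_one
  norm_one := norm_one
  star_add := star_add
  star_smul := fun r x => by simp
  star_star := star_star
  star_mul := star_mul
  inner_mul_left := fun x y z => by simp [Complex.inner]; ring
  inner_mul_right := fun x y z => by simp [Complex.inner]; ring
  star_mul_mul := fun x y => by
    apply Complex.ext <;> simp [Complex.sq_norm, Complex.normSq_apply] <;> ring
  mul_mul_star := fun x y => by
    apply Complex.ext <;> simp [Complex.sq_norm, Complex.normSq_apply] <;> ring
  exists_smul_one := fun x hx => ⟨x.re, by
    apply Complex.ext
    · simp
    · have := congrArg Complex.im hx
      simp at this ⊢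
      linarith⟩

theorem Quaternion.norm_sq_eq (x : ℍ[ℝ]) : ‖x‖ ^ 2 = normSq x := by
  rw [normSq_eq_norm_mul_self, sq]

instance : CompositionAlgebra ℍ[ℝ] where
  add_mul := add_mul
  mul_add := mul_add
  smul_mul := smul_mul_assoc
  mul_smul := fun r x y => mul_smul_comm r x y
  one_mul := one_mul
  mul_one := mul_one
  norm_one := norm_one
  star_add := star_add
  star_smul := fun r x => by simp
  star_star := star_star
  star_mul := star_mul
  inner_mul_left := fun x y z => by simp [Quaternion.inner_def]; ring
  inner_mul_right := fun x y z => by simp [Quaternion.inner_def]; ring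
  star_mul_mul := fun x y => by
    rw [← mul_assoc, Quaternion.star_mul_self, Quaternion.norm_sq_eq, Quaternion.coe_mul_eq_smul]
  mul_mul_star := fun x y => by
    rw [mul_assoc, Quaternion.self_mul_star, Quaternion.norm_sq_eq, Quaternion.mul_coe_eq_smul]
  exists_smul_one := fun x hx => ⟨x.re, by
    rw [Quaternion.star_eq_self] at hx
    rw [hx, Quaternion.re_coe, ← Quaternion.coe_mul_eq_smul, mul_one]⟩

/-! ### The octonions as a composition algebra -/

namespace Octonion

theorem ext_components {x y : Octonion} (h1 : x.fst = y.fst) (h2 : x.snd = y.snd) : x = y :=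
  (WithLp.ofLp_injective 2) (Prod.ext h1 h2)

theorem ext_re {x y : Octonion}
    (h0 : x.fst.re = y.fst.re) (h1 : x.fst.imI = y.fst.imI) (h2 : x.fst.imJ = y.fst.imJ)
    (h3 : x.fst.imK = y.fst.imK) (h4 : x.snd.re = y.snd.re) (h5 : x.snd.imI = y.snd.imI)
    (h6 : x.snd.imJ = y.snd.imJ) (h7 : x.snd.imK = y.snd.imK) : x = y :=
  ext_components (QuaternionAlgebra.ext h0 h1 h2 h3) (QuaternionAlgebra.ext h4 h5 h6 h7)

theorem fst_add (x y : Octonion) : (x + y).fst = x.fst + y.fst := rfl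
theorem snd_add (x y : Octonion) : (x + y).snd = x.snd + y.snd := rfl
theorem fst_smul (r : ℝ) (x : Octonion) : (r • x).fst = r • x.fst := rfl
theorem snd_smul (r : ℝ) (x : Octonion) : (r • x).snd = r • x.snd := rfl
theorem fst_one : (1 : Octonion).fst = 1 := rfl
theorem snd_one : (1 : Octonion).snd = 0 := rfl
theorem fst_star (x : Octonion) : (star x).fst = star x.fst := rfl
theorem snd_star (x : Octonion) : (star x).snd = -x.snd := rfl
theorem fst_mul (x y : Octonion) : (x * y).fst = x.fst * y.fst - y.snd * star x.snd := rfl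
theorem snd_mul (x y : Octonion) : (x * y).snd = star x.fst * y.snd + y.fst * x.snd := rfl

theorem inner_eq (x y : Octonion) :
    inner ℝ x y = inner ℝ x.fst y.fst + inner ℝ x.snd y.snd := rfl

theorem norm_sq_eq (x : Octonion) : ‖x‖ ^ 2 = normSq x.fst + normSq x.snd := by
  rw [← real_inner_self_eq_norm_sq, inner_eq, Quaternion.inner_self, Quaternion.inner_self]

theorem star_mul_mul_self (x y : Octonion) :
    star x * (x * y) = (normSq x.fst + normSq x.snd) • y := by
  apply ext_re <;>
  simp only [fst_mul, snd_mul, Quaternion.re_mul, Quaternion.imI_mul, Quaternion.imJ_mul,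
    Quaternion.imK_mul, Quaternion.re_sub, Quaternion.imI_sub, Quaternion.imJ_sub,
    Quaternion.imK_sub, Quaternion.re_add, Quaternion.imI_add, Quaternion.imJ_add,
    Quaternion.imK_add, Quaternion.re_star, Quaternion.imI_star, Quaternion.imJ_star,
    Quaternion.imK_star, fst_star, snd_star, fst_smul, snd_smul, Quaternion.normSq_def',
    Quaternion.re_neg, Quaternion.imI_neg, Quaternion.imJ_neg,
    Quaternion.imK_neg, Quaternion.re_smul, Quaternion.imI_smul, Quaternion.imJ_smul,
    Quaternion.imK_smul, smul_eq_mul] <;>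
  ring

theorem mul_mul_star_self (x y : Octonion) :
    (y * x) * star x = (normSq x.fst + normSq x.snd) • y := by
  apply ext_re <;>
  simp only [fst_mul, snd_mul, Quaternion.re_mul, Quaternion.imI_mul, Quaternion.imJ_mul,
    Quaternion.imK_mul, Quaternion.re_sub, Quaternion.imI_sub, Quaternion.imJ_sub,
    Quaternion.imK_sub, Quaternion.re_add, Quaternion.imI_add, Quaternion.imJ_add,
    Quaternion.imK_add, Quaternion.re_star, Quaternion.imI_star, Quaternion.imJ_star,
    Quaternion.imK_star, fst_star, snd_star, fst_smul, snd_smul, Quaternion.normSq_def',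
    Quaternion.re_neg, Quaternion.imI_neg, Quaternion.imJ_neg,
    Quaternion.imK_neg, Quaternion.re_smul, Quaternion.imI_smul, Quaternion.imJ_smul,
    Quaternion.imK_smul, smul_eq_mul] <;>
  ring

theorem mul_flexible (x y : Octonion) : (x * y) * x = x * (y * x) := by
  apply ext_re <;>
  simp only [fst_mul, snd_mul, Quaternion.re_mul, Quaternion.imI_mul, Quaternion.imJ_mul,
    Quaternion.imK_mul, Quaternion.re_sub, Quaternion.imI_sub, Quaternion.imJ_sub,
    Quaternion.imK_sub, Quaternion.re_add, Quaternion.imI_add, Quaternion.imJ_add,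
    Quaternion.imK_add, Quaternion.re_star, Quaternion.imI_star, Quaternion.imJ_star,
    Quaternion.imK_star] <;>
  ring

/-- The Moufang identities stand in for associativity in the automorphisms of the octonionic plane.
They are polynomial identities in the real coordinates. -/
theorem moufang_left (u x y : Octonion) : ((u * x) * u) * y = u * (x * (u * y)) := by
  apply ext_re <;>
  simp only [fst_mul, snd_mul, Quaternion.re_mul, Quaternion.imI_mul, Quaternion.imJ_mul,
    Quaternion.imK_mul, Quaternion.re_sub, Quaternion.imI_sub, Quaternion.imJ_sub,
    Quaternion.imK_sub, Quaternion.re_add, Quaternion.imI_add, Quaternion.imJ_add,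
    Quaternion.imK_add, Quaternion.re_star, Quaternion.imI_star, Quaternion.imJ_star,
    Quaternion.imK_star] <;>
  ring

theorem moufang_middle (u x y : Octonion) : (u * x) * (y * u) = u * (x * y) * u := by
  apply ext_re <;>
  simp only [fst_mul, snd_mul, Quaternion.re_mul, Quaternion.imI_mul, Quaternion.imJ_mul,
    Quaternion.imK_mul, Quaternion.re_sub, Quaternion.imI_sub, Quaternion.imJ_sub,
    Quaternion.imK_sub, Quaternion.re_add, Quaternion.imI_add, Quaternion.imJ_add,
    Quaternion.imK_add, Quaternion.re_star, Quaternion.imI_star, Quaternion.imJ_star,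
    Quaternion.imK_star] <;>
  ring

instance : CompositionAlgebra Octonion where
  add_mul := fun x y z => by
    apply ext_components
    · simp only [fst_mul, fst_add, snd_add, star_add]; noncomm_ring
    · simp only [snd_mul, fst_add, snd_add, star_add]; noncomm_ring
  mul_add := fun x y z => by
    apply ext_components
    · simp only [fst_mul, fst_add, snd_add]; noncomm_ring
    · simp only [snd_mul, fst_add, snd_add]; noncomm_ring
  smul_mul := fun r x y => by
    apply ext_components
    · simp [fst_mul, fst_smul, snd_smul, smul_sub]
    · simp [snd_mul, fst_smul, snd_smul]
  mul_smul := fun r x y => by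
    apply ext_components
    · simp [fst_mul, fst_smul, snd_smul, smul_sub]
    · simp [snd_mul, fst_smul, snd_smul]
  one_mul := fun x => by
    apply ext_components
    · simp [fst_mul, fst_one, snd_one]
    · simp [snd_mul, fst_one, snd_one]
  mul_one := fun x => by
    apply ext_components
    · simp [fst_mul, fst_one, snd_one]
    · simp [snd_mul, fst_one, snd_one]
  norm_one := by
    rw [← sq_eq_sq₀ (norm_nonneg _) zero_le_one, norm_sq_eq, fst_one, snd_one]
    simp
  star_add := fun x y => by
    apply ext_components
    · simp [fst_star, fst_add]
    · simp only [snd_star, snd_add, neg_add]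
  star_smul := fun r x => by
    apply ext_components
    · simp [fst_star, fst_smul]
    · simp [snd_star, snd_smul]
  star_star := fun x => by
    apply ext_components
    · simp [fst_star]
    · simp [snd_star]
  star_mul := fun x y => by
    apply ext_components
    · simp [fst_star, fst_mul, snd_star]
    · simp [snd_star, fst_star, snd_mul]
  inner_mul_left := fun x y z => by
    simp [inner_eq, Quaternion.inner_def, fst_mul, snd_mul, fst_star, snd_star]; ring
  inner_mul_right := fun x y z => by
    simp [inner_eq, Quaternion.inner_def, fst_mul, snd_mul, fst_star, snd_star]; ring
  star_mul_mul := fun x y => by rw [norm_sq_eq, star_mul_mul_self]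
  mul_mul_star := fun x y => by rw [norm_sq_eq, mul_mul_star_self]
  exists_smul_one := fun x hx => ⟨x.fst.re, by
    have h1 : star x.fst = x.fst := congrArg fst hx
    have h2 : -x.snd = x.snd := congrArg snd hx
    rw [Quaternion.star_eq_self] at h1
    apply ext_components
    · rw [h1, fst_smul, fst_one, Quaternion.re_coe, ← Quaternion.coe_mul_eq_smul, mul_one]
    · rw [snd_smul, snd_one, smul_zero]
      have h3 : (2 : ℝ) • x.snd = 0 := by
        rw [two_smul]
        nth_rw 1 [← h2]
        exact neg_add_cancel _
      exact (smul_eq_zero.mp h3).resolve_left two_ne_zero⟩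

theorem finrank_eq : Module.finrank ℝ Octonion = 8 := by
  change Module.finrank ℝ (WithLp 2 (ℍ[ℝ] × ℍ[ℝ])) = 8
  rw [(WithLp.linearEquiv 2 ℝ (ℍ[ℝ] × ℍ[ℝ])).finrank_eq, Module.finrank_prod,
    Quaternion.finrank_eq_four]

instance : FiniteDimensional ℝ Octonion :=
  inferInstanceAs (FiniteDimensional ℝ (WithLp 2 (ℍ[ℝ] × ℍ[ℝ])))

end Octonion

/-! ### Consequences of the axioms, and projectors of trace one -/

namespace CompositionAlgebra

section Algebra

variable {F : Type} [NormedAddCommGroup F] [InnerProductSpace ℝ F] [Mul F] [One F] [Star F]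
  [CompositionAlgebra F]

theorem self_mul_star (x : F) : x * star x = ‖x‖ ^ 2 • (1 : F) := by
  have h := mul_mul_star x 1
  rwa [one_mul] at h

theorem star_mul_self (x : F) : star x * x = ‖x‖ ^ 2 • (1 : F) := by
  have h := star_mul_mul x 1
  rwa [mul_one] at h

theorem inner_one_one : inner ℝ (1 : F) 1 = 1 := by
  rw [real_inner_self_eq_norm_sq, norm_one, one_pow]

theorem smul_one_injective {r s : ℝ} (h : r • (1 : F) = s • (1 : F)) : r = s := by
  have := congrArg (inner ℝ (1 : F)) h
  simpa only [inner_smul_right, inner_one_one, _root_.mul_one] using this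

theorem star_one : star (1 : F) = 1 := by
  have h := mul_one (star (1 : F))
  rw [star_mul_self, norm_one, one_pow, one_smul] at h
  exact h.symm

theorem norm_star (x : F) : ‖star x‖ = ‖x‖ := by
  have h := star_mul_self (star x)
  rw [star_star, self_mul_star] at h
  exact ((sq_eq_sq₀ (norm_nonneg _) (norm_nonneg _)).mp (smul_one_injective h)).symm

/-- Adjointness and the alternative law give `‖x y‖² = ⟨y, x̄ (x y)⟩ = ‖x‖² ‖y‖²`. -/
theorem norm_mul (x y : F) : ‖x * y‖ = ‖x‖ * ‖y‖ := by
  rw [← sq_eq_sq₀ (norm_nonneg _) (by positivity), ← real_inner_self_eq_norm_sq, inner_mul_left,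
    star_mul_mul, inner_smul_right, real_inner_self_eq_norm_sq, mul_pow]

theorem mul_eq_zero_iff {x y : F} : x * y = 0 ↔ x = 0 ∨ y = 0 := by
  rw [← norm_eq_zero, norm_mul, mul_eq_zero, norm_eq_zero, norm_eq_zero]

theorem mul_star_mul {u : F} (x : F) (hu : ‖u‖ = 1) : u * (star u * x) = x := by
  have h := star_mul_mul (star u) x
  rwa [star_star, norm_star, hu, one_pow, one_smul] at h

theorem mul_star_mul_self {u : F} (x : F) (hu : ‖u‖ = 1) : x * star u * u = x := by
  have h := mul_mul_star (star u) x
  rwa [star_star, norm_star, hu, one_pow, one_smul] at h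

variable (F) in
/-- The product as a bilinear map. -/
def mulBilin : F →ₗ[ℝ] F →ₗ[ℝ] F :=
  LinearMap.mk₂ ℝ (· * ·) add_mul smul_mul mul_add mul_smul

variable (F) in
/-- The conjugation as a linear map. -/
def starLinear : F →ₗ[ℝ] F where
  toFun := star
  map_add' := star_add
  map_smul' := star_smul

/-- Left multiplication by an element of norm one. -/
def mulLeftIsometry (u : F) (hu : ‖u‖ = 1) : F ≃ₗᵢ[ℝ] F where
  toFun x := u * x
  invFun x := star u * x
  map_add' := mul_add u
  map_smul' r x := mul_smul r u x
  left_inv x := by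
    have := star_mul_mul u x
    rwa [hu, one_pow, one_smul] at this
  right_inv x := mul_star_mul x hu
  norm_map' x := by
    change ‖u * x‖ = ‖x‖
    rw [norm_mul, hu, _root_.one_mul]

/-- Right multiplication by an element of norm one. -/
def mulRightIsometry (u : F) (hu : ‖u‖ = 1) : F ≃ₗᵢ[ℝ] F where
  toFun x := x * u
  invFun x := x * star u
  map_add' x y := add_mul x y u
  map_smul' r x := smul_mul r x u
  left_inv x := by
    have := mul_mul_star u x
    rwa [hu, one_pow, one_smul] at this
  right_inv x := mul_star_mul_self x hu
  norm_map' x := by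
    change ‖x * u‖ = ‖x‖
    rw [norm_mul, hu, _root_.mul_one]

/-- The unit `x̄ / ‖x‖` turns a matrix entry into a real one; if `x = 0`, any unit will do. -/
theorem exists_norm_one_mul (x : F) :
    ∃ u : F, ‖u‖ = 1 ∧ u * x = ‖x‖ • (1 : F) ∧ x * u = ‖x‖ • (1 : F) := by
  by_cases hx : x = 0
  · refine ⟨1, norm_one, ?_, ?_⟩
    · rw [hx, norm_zero, zero_smul, one_mul]
    · rw [hx, norm_zero, zero_smul, mul_one]
  · have hn : ‖x‖ ≠ 0 := norm_ne_zero_iff.mpr hx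
    refine ⟨‖x‖⁻¹ • star x, ?_, ?_, ?_⟩
    · rw [norm_smul, norm_star, norm_inv, norm_norm, inv_mul_cancel₀ hn]
    · rw [smul_mul, star_mul_self, smul_smul, sq, inv_mul_cancel_left₀ hn]
    · rw [mul_smul, self_mul_star, smul_smul, sq, inv_mul_cancel_left₀ hn]

end Algebra

section Projectors

variable (F : Type) [NormedAddCommGroup F] [InnerProductSpace ℝ F] [Mul F] [One F] [Star F]

/-- The space of square matrices with the Euclidean norm. -/
abbrev MatrixSpace (n : ℕ) : Type := PiLp 2 (fun _ : Fin (n + 1) × Fin (n + 1) => F)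

variable {F} {n : ℕ}

/-- Hermitian idempotent matrices of trace one. -/
def IsProjector (P : MatrixSpace F n) : Prop :=
  (∀ i j, P (i, j) = star (P (j, i))) ∧
  (∀ i j, ∑ k, P (i, k) * P (k, j) = P (i, j)) ∧
  ∑ i, P (i, i) = 1

variable [CompositionAlgebra F]

theorem sum_mul_left {ι : Type*} (s : Finset ι) (f : ι → F) (x : F) :
    (∑ i ∈ s, f i) * x = ∑ i ∈ s, f i * x := map_sum ((mulBilin F).flip x) f s

theorem mul_sum_right {ι : Type*} (s : Finset ι) (f : ι → F) (x : F) :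
    x * (∑ i ∈ s, f i) = ∑ i ∈ s, x * f i := map_sum (mulBilin F x) f s

theorem star_sum_eq {ι : Type*} (s : Finset ι) (f : ι → F) :
    star (∑ i ∈ s, f i) = ∑ i ∈ s, star (f i) := map_sum (starLinear F) f s

/-- The real part of a diagonal entry. -/
def diagRe (P : MatrixSpace F n) (i : Fin (n + 1)) : ℝ := inner ℝ 1 (P (i, i))

theorem diag_eq_smul_one {P : MatrixSpace F n} (hP : ∀ i j, P (i, j) = star (P (j, i)))
    (i : Fin (n + 1)) : P (i, i) = diagRe P i • (1 : F) := by
  obtain ⟨r, hr⟩ := exists_smul_one _ (hP i i).symm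
  rw [diagRe, hr, inner_smul_right, inner_one_one, _root_.mul_one]

namespace IsProjector

variable {P : MatrixSpace F n}

theorem sum_norm_sq (hP : IsProjector P) (i : Fin (n + 1)) :
    ∑ k, ‖P (i, k)‖ ^ 2 = diagRe P i := by
  apply smul_one_injective (F := F)
  rw [← diag_eq_smul_one hP.1, ← hP.2.1 i i, Finset.sum_smul]
  refine Finset.sum_congr rfl fun k _ => ?_
  rw [hP.1 k i, self_mul_star]

theorem norm_symm (hP : IsProjector P) (i j : Fin (n + 1)) : ‖P (i, j)‖ = ‖P (j, i)‖ := by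
  rw [hP.1 i j, norm_star]

theorem sum_diagRe (hP : IsProjector P) : ∑ i, diagRe P i = 1 := by
  simp only [diagRe, ← inner_sum]
  rw [hP.2.2, inner_one_one]

theorem norm_eq_one (hP : IsProjector P) : ‖P‖ = 1 := by
  rw [← sq_eq_sq₀ (norm_nonneg _) zero_le_one, PiLp.norm_sq_eq_of_L2, Fintype.sum_prod_type]
  simp_rw [hP.sum_norm_sq]
  rw [hP.sum_diagRe, one_pow]

theorem diagRe_nonneg (hP : IsProjector P) (i : Fin (n + 1)) : 0 ≤ diagRe P i := by
  rw [← hP.sum_norm_sq]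
  positivity

/-- A projector of trace one has rank one. -/
theorem mul_eq_smul (hP : IsProjector P) (i j k : Fin (n + 1)) :
    P (i, k) * P (k, j) = diagRe P k • P (i, j) := by
  have hcol : ∑ i, ‖P (i, k)‖ ^ 2 = diagRe P k := by
    rw [← hP.sum_norm_sq]
    exact Finset.sum_congr rfl fun i _ => by rw [hP.norm_symm]
  set p := diagRe P k with hp
  by_cases hp0 : p = 0
  · have h := (Finset.sum_eq_zero_iff_of_nonneg fun i _ => sq_nonneg _).mp (hcol.trans hp0) i
      (Finset.mem_univ i)
    have h' : P (i, k) = 0 := norm_eq_zero.mp (pow_eq_zero_iff two_ne_zero |>.mp h)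
    rw [h', hp0, zero_smul, mul_eq_zero_iff]
    exact Or.inl rfl
  have hrow : ∑ j, ‖P (k, j)‖ ^ 2 = p := hP.sum_norm_sq k
  have htot : ∑ i, ∑ j, ‖P (i, j)‖ ^ 2 = 1 := by
    simp_rw [hP.sum_norm_sq]
    exact hP.sum_diagRe
  -- Adjointness moves `P (i, k)` to the other side, where the sum over `i` is an entry of `P² = P`.
  -- No associativity is needed.
  have hcross : ∑ i, ∑ j, inner ℝ (P (i, k) * P (k, j)) (P (i, j)) = p := by
    rw [Finset.sum_comm, ← hrow]
    refine Finset.sum_congr rfl fun j _ => ?_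
    simp_rw [inner_mul_left, ← hP.1 k]
    rw [← inner_sum, hP.2.1, real_inner_self_eq_norm_sq]
  have hprod : ∑ i, ∑ j, ‖P (i, k) * P (k, j)‖ ^ 2 = p ^ 2 := by
    simp_rw [norm_mul, mul_pow, ← Finset.mul_sum, hrow, ← Finset.sum_mul, hcol]
    ring
  -- Expanding the squares gives `p² - 2 p · p + p² · 1 = 0`, so every term vanishes.
  have hzero : ∑ i, ∑ j, ‖P (i, k) * P (k, j) - p • P (i, j)‖ ^ 2 = 0 := by
    simp_rw [norm_sub_sq_real, inner_smul_right, norm_smul, mul_pow, Finset.sum_add_distrib,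
      Finset.sum_sub_distrib, ← Finset.mul_sum, hprod, hcross, htot, Real.norm_eq_abs, sq_abs]
    ring
  have h1 := (Finset.sum_eq_zero_iff_of_nonneg fun i _ => by positivity).mp hzero i
    (Finset.mem_univ i)
  have h2 := (Finset.sum_eq_zero_iff_of_nonneg fun i _ => by positivity).mp h1 j
    (Finset.mem_univ j)
  exact sub_eq_zero.mp (norm_eq_zero.mp (pow_eq_zero_iff two_ne_zero |>.mp h2))

/-- Pigeonhole: the `n + 1` diagonal entries sum to `1`. -/
theorem exists_diagRe_ge (hP : IsProjector P) : ∃ k, ((n : ℝ) + 1)⁻¹ ≤ diagRe P k := by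
  by_contra! h
  have h1 : ∑ i, diagRe P i < ∑ _i : Fin (n + 1), ((n : ℝ) + 1)⁻¹ :=
    Finset.sum_lt_sum_of_nonempty Finset.univ_nonempty fun i _ => h i
  rw [hP.sum_diagRe, Finset.sum_const, Finset.card_univ, Fintype.card_fin, nsmul_eq_mul] at h1
  push_cast at h1
  rw [mul_inv_cancel₀ (by positivity)] at h1
  exact lt_irrefl _ h1

end IsProjector

end Projectors

end CompositionAlgebra

/-! ### Affine charts and the Hausdorff measure of projective spaces -/

namespace CompositionAlgebra

section ChartSpace

/-- The coordinate space of an affine chart. -/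
abbrev ChartSpace (F : Type) (n : ℕ) : Type := PiLp 2 (fun _ : Fin n => F)

variable {F : Type} [NormedAddCommGroup F] {n : ℕ}

/-- The entries of the first column below the diagonal. -/
def firstColumn (P : MatrixSpace F n) : ChartSpace F n :=
  WithLp.toLp 2 fun i => P (i.succ, 0)

theorem lipschitzWith_firstColumn : LipschitzWith 1 (firstColumn (F := F) (n := n)) := by
  refine LipschitzWith.of_dist_le_mul fun P R => ?_
  rw [NNReal.coe_one, _root_.one_mul, dist_eq_norm, dist_eq_norm]
  refine abs_le_of_sq_le_sq' ?_ (norm_nonneg _) |>.2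
  rw [PiLp.norm_sq_eq_of_L2, PiLp.norm_sq_eq_of_L2, Fintype.sum_prod_type_right,
    Fin.sum_univ_succ]
  refine le_add_of_le_of_nonneg ?_ (by positivity)
  rw [Fin.sum_univ_succ]
  exact le_add_of_nonneg_left (by positivity)

theorem finrank_chartSpace [InnerProductSpace ℝ F] [FiniteDimensional ℝ F] :
    Module.finrank ℝ (ChartSpace F n) = n * Module.finrank ℝ F := by
  rw [(WithLp.linearEquiv 2 ℝ (Fin n → F)).finrank_eq, Module.finrank_pi_fintype]
  simp

end ChartSpace

section Charts

variable {F : Type} [NormedAddCommGroup F] [InnerProductSpace ℝ F] [Mul F] [One F] [Star F]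
  {n : ℕ}

variable (F n) in
/-- The vectors with one entry equal to `1` define projectors on lines. -/
def HasLineProjectors : Prop :=
  ∀ z : Fin (n + 1) → F, (∃ k, z k = 1) → ∀ i m j,
    (z i * star (z m)) * (z m * star (z j)) = ‖z m‖ ^ 2 • (z i * star (z j))

/-- The matrix `z z* / |z|²`. -/
def lineProjector (z : Fin (n + 1) → F) : MatrixSpace F n :=
  WithLp.toLp 2 fun p => (∑ m, ‖z m‖ ^ 2)⁻¹ • (z p.1 * star (z p.2))

variable [CompositionAlgebra F]

theorem isProjector_lineProjector (hF : HasLineProjectors F n) {z : Fin (n + 1) → F}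
    (hz : ∃ k, z k = 1) : IsProjector (lineProjector z) := by
  set N := ∑ m, ‖z m‖ ^ 2 with hN
  have hN0 : N ≠ 0 := by
    obtain ⟨k, hk⟩ := hz
    have h1 : ‖z k‖ ^ 2 ≤ N :=
      Finset.single_le_sum (f := fun m => ‖z m‖ ^ 2) (fun _ _ => by positivity) (Finset.mem_univ k)
    rw [hk, norm_one] at h1
    linarith
  refine ⟨fun i j => ?_, fun i j => ?_, ?_⟩
  · simp only [lineProjector, star_smul, star_mul, star_star]
  · simp only [lineProjector, smul_mul, mul_smul, hF z hz, ← hN]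
    simp_rw [smul_smul, ← Finset.sum_smul, ← Finset.mul_sum, ← hN]
    rw [inv_mul_cancel₀ hN0, _root_.mul_one]
  · simp only [lineProjector, ← hN, self_mul_star, ← Finset.sum_smul, ← Finset.smul_sum]
    rw [smul_smul, inv_mul_cancel₀ hN0, one_smul]

/-- The affine chart with the `k`-th homogeneous coordinate equal to `1`. -/
def affineChart (k : Fin (n + 1)) (x : ChartSpace F n) : MatrixSpace F n :=
  lineProjector (k.insertNth (α := fun _ => F) 1 x)

theorem isProjector_affineChart (hF : HasLineProjectors F n) (k : Fin (n + 1))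
    (x : ChartSpace F n) : IsProjector (affineChart k x) :=
  isProjector_lineProjector hF ⟨k, by simp⟩

/-- The continuous bilinear map `(x, y) ↦ x y*`. -/
def mulStarCLM : F →L[ℝ] F →L[ℝ] F :=
  ((mulBilin F).compl₂ (starLinear F)).mkContinuous₂ 1 fun x y => by
    change ‖x * star y‖ ≤ _
    rw [norm_mul, norm_star, _root_.one_mul]

theorem locallyLipschitz_affineChart (k : Fin (n + 1)) :
    LocallyLipschitz (affineChart (F := F) k) := by
  have hz : ∀ i, ContDiff ℝ 1 fun x : ChartSpace F n => k.insertNth (α := fun _ => F) 1 x i := by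
    intro i
    refine Fin.succAboveCases k ?_ (fun j => ?_) i
    · simpa using contDiff_const
    · simp only [Fin.insertNth_apply_succAbove]
      exact (PiLp.proj (𝕜 := ℝ) 2 (fun _ : Fin n => F) j).contDiff
  have hN : ContDiff ℝ 1 fun x : ChartSpace F n =>
      (∑ m, ‖k.insertNth (α := fun _ => F) 1 x m‖ ^ 2)⁻¹ := by
    refine ContDiff.inv (ContDiff.sum fun m _ => (hz m).norm_sq ℝ) fun x => ?_
    -- The coordinate equal to `1` keeps the denominator away from zero.
    have h1 : ‖k.insertNth (α := fun _ => F) (1 : F) x k‖ ^ 2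
        ≤ ∑ m, ‖k.insertNth (α := fun _ => F) 1 x m‖ ^ 2 :=
      Finset.single_le_sum (f := fun m => ‖k.insertNth (α := fun _ => F) (1 : F) x m‖ ^ 2)
        (fun _ _ => by positivity) (Finset.mem_univ k)
    rw [Fin.insertNth_apply_same, norm_one] at h1
    linarith
  refine ContDiff.locallyLipschitz (𝕂 := ℝ) ?_
  rw [contDiff_piLp]
  rintro ⟨i, j⟩
  exact hN.smul (((mulStarCLM (F := F)).contDiff.comp (hz i)).clm_apply (hz j))

/-- Column `k` divided by `p = P_kk` gives homogeneous coordinates with `k`-th entry `1` and squared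
norm `1/p ≤ n + 1`. They recover `P` by the rank-one identity `P_ik P_kj = p P_ij`. -/
theorem IsProjector.exists_affineChart {P : MatrixSpace F n} (hP : IsProjector P)
    {k : Fin (n + 1)} (hk : ((n : ℝ) + 1)⁻¹ ≤ diagRe P k) :
    ∃ x ∈ Metric.closedBall (0 : ChartSpace F n) (n + 1), affineChart k x = P := by
  set p := diagRe P k with hp
  have hn : (0 : ℝ) < n + 1 := by positivity
  have hp0 : 0 < p := (inv_pos.mpr hn).trans_le hk
  set x : ChartSpace F n := WithLp.toLp 2 fun i => p⁻¹ • P (k.succAbove i, k) with hx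
  have hz : k.insertNth (α := fun _ => F) 1 x = fun i => p⁻¹ • P (i, k) := by
    ext i
    refine Fin.succAboveCases k ?_ (fun j => ?_) i
    · simp only [Fin.insertNth_apply_same]
      rw [diag_eq_smul_one hP.1, smul_smul, inv_mul_cancel₀ hp0.ne', one_smul]
    · simp only [Fin.insertNth_apply_succAbove, hx]
  have hN : ∑ m, ‖p⁻¹ • P (m, k)‖ ^ 2 = p⁻¹ := by
    simp_rw [norm_smul, mul_pow, ← Finset.mul_sum, hP.norm_symm _ k, hP.sum_norm_sq]
    rw [norm_inv, Real.norm_of_nonneg hp0.le, ← hp]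
    field_simp
  refine ⟨x, ?_, ?_⟩
  · rw [mem_closedBall_zero_iff]
    have h1 : ‖x‖ ^ 2 ≤ p⁻¹ := by
      rw [← hN, Fin.sum_univ_succAbove _ k, PiLp.norm_sq_eq_of_L2]
      exact le_add_of_nonneg_left (by positivity)
    have h2 : p⁻¹ ≤ n + 1 := inv_le_of_inv_le₀ hn hk
    have h3 : (1 : ℝ) ≤ n + 1 := by linarith [(Nat.cast_nonneg n : (0 : ℝ) ≤ n)]
    refine abs_le_of_sq_le_sq' ?_ hn.le |>.2
    nlinarith
  · rw [affineChart, hz]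
    ext ⟨i, j⟩
    simp only [lineProjector, hN]
    rw [inv_inv, star_smul, ← hP.1 k j, smul_mul, mul_smul, hP.mul_eq_smul, smul_smul, smul_smul,
      smul_smul, ← hp]
    field_simp
    rw [one_smul]

theorem isProjector_subset_iUnion :
    {P : MatrixSpace F n | IsProjector P} ⊆
      ⋃ k, affineChart k '' Metric.closedBall (0 : ChartSpace F n) (n + 1) := by
  intro P hP
  obtain ⟨k, hk⟩ := IsProjector.exists_diagRe_ge hP
  obtain ⟨x, hx, hxP⟩ := IsProjector.exists_affineChart hP hk
  exact Set.mem_iUnion.mpr ⟨k, x, hx, hxP⟩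

/-- The chart at `w = y / p` has first column `w / (1 + ‖w‖²)`, which is `y` as soon as `‖y‖² = p -
p²`. This is solvable for `‖y‖ < 1/2`, and `p` is the larger root. -/
theorem ball_subset_firstColumn_image (hF : HasLineProjectors F n) :
    Metric.ball (0 : ChartSpace F n) (1 / 2) ⊆
      firstColumn '' {P : MatrixSpace F n | IsProjector P} := by
  intro y hy
  rw [mem_ball_zero_iff] at hy
  set s := √(1 - 4 * ‖y‖ ^ 2) with hs
  have hs2 : s ^ 2 = 1 - 4 * ‖y‖ ^ 2 := Real.sq_sqrt (by nlinarith [norm_nonneg y])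
  have hs0 : 0 ≤ s := Real.sqrt_nonneg _
  set p := (1 + s) / 2 with hp
  have hp0 : 0 < p := by positivity
  have hpy : ‖y‖ ^ 2 = p - p ^ 2 := by rw [hp]; linarith
  set w : ChartSpace F n := p⁻¹ • y with hw
  refine ⟨affineChart 0 w, isProjector_affineChart hF _ _, ?_⟩
  have hN : ∑ m, ‖(0 : Fin (n + 1)).insertNth (α := fun _ => F) (1 : F) w m‖ ^ 2
      = p⁻¹ := by
    rw [Fin.sum_univ_succ]
    have h1 : ∑ i : Fin n, ‖(0 : Fin (n + 1)).insertNth (α := fun _ => F) (1 : F) w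
        i.succ‖ ^ 2 = ‖w‖ ^ 2 := by
      rw [PiLp.norm_sq_eq_of_L2]
      refine Finset.sum_congr rfl fun i _ => ?_
      rw [← Fin.succAbove_zero_apply, Fin.insertNth_apply_succAbove]
    rw [h1, Fin.insertNth_apply_same, norm_one, hw, norm_smul, mul_pow, hpy, norm_inv,
      Real.norm_of_nonneg hp0.le]
    field_simp
    ring
  ext i
  simp only [firstColumn, affineChart, lineProjector]
  rw [hN, Fin.insertNth_apply_same, star_one, mul_one, inv_inv, ← Fin.succAbove_zero_apply,
    Fin.insertNth_apply_succAbove, hw, PiLp.smul_apply, smul_smul, mul_inv_cancel₀ hp0.ne',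
      one_smul]

variable [FiniteDimensional ℝ F]

open MeasureTheory.Measure in
theorem hausdorffMeasure_projectiveSpace (hF : HasLineProjectors F n) {d : ℕ}
    (hd : n * Module.finrank ℝ F = d) :
    0 < (μH[(d : ℝ)] : Measure (ProjectiveSpace F n)) Set.univ ∧
      (μH[(d : ℝ)] : Measure (ProjectiveSpace F n)) Set.univ < ⊤ := by
  let _ : MeasurableSpace (MatrixSpace F n) := borel _
  have : BorelSpace (MatrixSpace F n) := ⟨rfl⟩
  have hiso : Isometry (fun P : ProjectiveSpace F n => P.1) := fun _ _ => rfl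
  have hu : (μH[(d : ℝ)] : Measure (ProjectiveSpace F n)) Set.univ
      = (μH[(d : ℝ)] : Measure (MatrixSpace F n)) {P | IsProjector P} := by
    rw [← hiso.hausdorffMeasure_image (Or.inl (by positivity)), Set.image_univ]
    congr 1
    exact Subtype.range_coe
  rw [hu]
  have hfr := (finrank_chartSpace (F := F) (n := n)).trans hd
  refine ⟨hausdorffMeasure_pos_of_ball_subset_image hfr lipschitzWith_firstColumn
    one_half_pos (ball_subset_firstColumn_image hF), ?_⟩
  refine (measure_mono isProjector_subset_iUnion).trans_lt ?_
  refine (measure_iUnion_le _).trans_lt ?_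
  rw [tsum_fintype]
  refine ENNReal.sum_lt_top.mpr fun k _ => ?_
  exact hausdorffMeasure_image_lt_top hfr (locallyLipschitz_affineChart k)
    (isCompact_closedBall _ _)

end Charts

end CompositionAlgebra

/-! ### Conjugation by real orthogonal matrices -/

section RealAction

open scoped Matrix

variable {F ι : Type} [NormedAddCommGroup F] [InnerProductSpace ℝ F] [Fintype ι]

/-- The action of a real square matrix on vectors with entries in a real vector space. -/
def Matrix.piLpAction (M : Matrix ι ι ℝ) :
    PiLp 2 (fun _ : ι => F) →ₗ[ℝ] PiLp 2 (fun _ : ι => F) where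
  toFun x := WithLp.toLp 2 fun p => ∑ q, M p q • x q
  map_add' x y := by ext p; simp [smul_add, Finset.sum_add_distrib]
  map_smul' r x := by ext p; simp [Finset.smul_sum, smul_comm r]

theorem Matrix.piLpAction_apply (M : Matrix ι ι ℝ) (x : PiLp 2 (fun _ : ι => F)) (p : ι) :
    M.piLpAction x p = ∑ q, M p q • x q := rfl

theorem Matrix.piLpAction_mul (M N : Matrix ι ι ℝ) (x : PiLp 2 (fun _ : ι => F)) :
    (M * N).piLpAction x = M.piLpAction (N.piLpAction x) := by
  ext p
  simp only [Matrix.piLpAction_apply, Matrix.mul_apply, Finset.sum_smul, Finset.smul_sum,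
    smul_smul]
  exact Finset.sum_comm

theorem Matrix.piLpAction_one [DecidableEq ι] (x : PiLp 2 (fun _ : ι => F)) :
    (1 : Matrix ι ι ℝ).piLpAction x = x := by
  ext p
  simp [Matrix.piLpAction_apply, Matrix.one_apply]

theorem Matrix.inner_piLpAction (M : Matrix ι ι ℝ) (x y : PiLp 2 (fun _ : ι => F)) :
    inner ℝ (M.piLpAction x) y = inner ℝ x (Mᵀ.piLpAction y) := by
  simp only [PiLp.inner_apply, Matrix.piLpAction_apply, sum_inner, inner_sum, inner_smul_left,
    inner_smul_right, Matrix.transpose_apply]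
  exact Finset.sum_comm

/-- The isometry of `F^ι` given by a real orthogonal matrix. -/
def Matrix.piLpIsometry [DecidableEq ι] (M : Matrix ι ι ℝ) (h : M * Mᵀ = 1) :
    PiLp 2 (fun _ : ι => F) ≃ₗᵢ[ℝ] PiLp 2 (fun _ : ι => F) where
  toLinearMap := M.piLpAction
  invFun := Mᵀ.piLpAction
  left_inv x := by
    change Mᵀ.piLpAction (M.piLpAction x) = x
    rw [← Matrix.piLpAction_mul, mul_eq_one_comm.mp h, Matrix.piLpAction_one]
  right_inv x := by
    change M.piLpAction (Mᵀ.piLpAction x) = x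
    rw [← Matrix.piLpAction_mul, h, Matrix.piLpAction_one]
  norm_map' x := by
    change ‖M.piLpAction x‖ = ‖x‖
    rw [← sq_eq_sq₀ (norm_nonneg _) (norm_nonneg _), ← real_inner_self_eq_norm_sq,
      Matrix.inner_piLpAction, ← Matrix.piLpAction_mul, mul_eq_one_comm.mp h,
      Matrix.piLpAction_one, real_inner_self_eq_norm_sq]

/-- Extend the family to an orthonormal basis and take its vectors as the rows of `O`. -/
theorem exists_orthogonal_mulVec_eq_single [DecidableEq ι] {s : Set ι}
    {u : ι → EuclideanSpace ℝ ι} (hu : Orthonormal ℝ (s.domRestrict u)) :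
    ∃ O : Matrix ι ι ℝ, O * Oᵀ = 1 ∧ ∀ i ∈ s, O *ᵥ (u i) = Pi.single i 1 := by
  obtain ⟨b, hb⟩ := hu.exists_orthonormalBasis_extension_of_card_eq (ι := ι) (by simp)
  have hin : ∀ i j, ∑ k, b i k * b j k = if i = j then 1 else 0 := by
    intro i j
    rw [← orthonormal_iff_ite.mp b.orthonormal i j, PiLp.inner_apply]
    exact Finset.sum_congr rfl fun k _ => by simp [mul_comm]
  refine ⟨Matrix.of fun i k => b i k, ?_, fun i hi => ?_⟩
  · ext i j
    rw [Matrix.mul_apply, Matrix.one_apply, ← hin]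
    rfl
  · ext j
    rw [← hb i hi, Pi.single_apply]
    exact hin j i

end RealAction

namespace CompositionAlgebra

section Conjugation

open scoped Matrix Kronecker

variable {F : Type} [NormedAddCommGroup F] [InnerProductSpace ℝ F] {n : ℕ}

theorem sum_orthogonal {O : Matrix (Fin (n + 1)) (Fin (n + 1)) ℝ} (hO : O * Oᵀ = 1)
    (a b : Fin (n + 1)) : ∑ k, O k a * O k b = if a = b then 1 else 0 := by
  have h := congrArg (fun M : Matrix (Fin (n + 1)) (Fin (n + 1)) ℝ => M a b)
    (mul_eq_one_comm.mp hO)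
  simpa [Matrix.mul_apply, Matrix.one_apply] using h

/-- Conjugation by a real orthogonal matrix. -/
def conjOrthogonal (O : Matrix (Fin (n + 1)) (Fin (n + 1)) ℝ) (hO : O * Oᵀ = 1) :
    MatrixSpace F n ≃ₗᵢ[ℝ] MatrixSpace F n :=
  (O ⊗ₖ O).piLpIsometry (by
    rw [← Matrix.kroneckerMap_transpose, ← Matrix.mul_kronecker_mul, hO, Matrix.one_kronecker_one])

theorem conjOrthogonal_apply (O : Matrix (Fin (n + 1)) (Fin (n + 1)) ℝ) (hO : O * Oᵀ = 1)
    (P : MatrixSpace F n) (i j : Fin (n + 1)) :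
    conjOrthogonal O hO P (i, j) = ∑ a, ∑ b, (O i a * O j b) • P (a, b) :=
  Fintype.sum_prod_type _

/-- The coefficient form of `(O P Oᵀ)(O P Oᵀ) = O P² Oᵀ`. The real factors move out of any bilinear
product, so associativity of `F` plays no role. -/
theorem sum_orthogonal_smul {O : Matrix (Fin (n + 1)) (Fin (n + 1)) ℝ} (hO : O * Oᵀ = 1)
    (f : Fin (n + 1) → Fin (n + 1) → Fin (n + 1) → Fin (n + 1) → F) (i j : Fin (n + 1)) :
    ∑ k, ∑ a, ∑ b, ∑ c, ∑ d, ((O i a * O k b) * (O k c * O j d)) • f a b c d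
      = ∑ a, ∑ d, (O i a * O j d) • ∑ b, f a b b d := by
  rw [Finset.sum_comm]
  refine Finset.sum_congr rfl fun a _ => ?_
  simp_rw [Finset.smul_sum]
  rw [Finset.sum_comm, Finset.sum_comm (γ := Fin (n + 1)) (f := fun d b => _ • _)]
  refine Finset.sum_congr rfl fun b _ => ?_
  calc ∑ k, ∑ c, ∑ d, ((O i a * O k b) * (O k c * O j d)) • f a b c d
      = ∑ c, ∑ d, ∑ k, ((O i a * O k b) * (O k c * O j d)) • f a b c d := by
        rw [Finset.sum_comm]
        exact Finset.sum_congr rfl fun c _ => Finset.sum_comm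
    _ = ∑ c, ∑ d, if b = c then (O i a * O j d) • f a b c d else 0 := by
        refine Finset.sum_congr rfl fun c _ => Finset.sum_congr rfl fun d _ => ?_
        have h : ∑ k, (O i a * O k b) * (O k c * O j d)
            = (O i a * O j d) * ∑ k, O k b * O k c := by
          rw [Finset.mul_sum]
          exact Finset.sum_congr rfl fun k _ => by ring
        rw [← Finset.sum_smul, h, sum_orthogonal hO]
        split_ifs <;> simp
    _ = ∑ d, (O i a * O j d) • f a b b d := by
        rw [Finset.sum_comm]
        exact Finset.sum_congr rfl fun d _ => by simp

variable [One F]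

/-- The real matrix `v wᵀ`. -/
def realMatrix (v w : Fin (n + 1) → ℝ) : MatrixSpace F n :=
  WithLp.toLp 2 fun p => (v p.1 * w p.2) • (1 : F)

theorem conjOrthogonal_realMatrix (O : Matrix (Fin (n + 1)) (Fin (n + 1)) ℝ) (hO : O * Oᵀ = 1)
    (v w : Fin (n + 1) → ℝ) :
    conjOrthogonal O hO (realMatrix v w : MatrixSpace F n) = realMatrix (O *ᵥ v) (O *ᵥ w) := by
  ext ⟨i, j⟩
  rw [conjOrthogonal_apply]
  simp only [realMatrix, smul_smul, ← Finset.sum_smul, Matrix.mulVec, dotProduct,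
    Finset.sum_mul_sum]
  congr 1
  exact Finset.sum_congr rfl fun a _ => Finset.sum_congr rfl fun b _ => by ring

end Conjugation

section Entries

variable {F : Type} [NormedAddCommGroup F] [Mul F] [One F] [Star F]
  {n : ℕ}

/-- The conjugate transpose. -/
def dagger (P : MatrixSpace F n) : MatrixSpace F n := WithLp.toLp 2 fun p => star (P (p.2, p.1))

/-- The square of a matrix. -/
def matSq (P : MatrixSpace F n) : MatrixSpace F n :=
  WithLp.toLp 2 fun p => ∑ k, P (p.1, k) * P (k, p.2)

theorem isProjector_iff {P : MatrixSpace F n} :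
    IsProjector P ↔ dagger P = P ∧ matSq P = P ∧ ∑ i, P (i, i) = 1 := by
  refine and_congr ?_ (and_congr ?_ Iff.rfl)
  · refine ⟨fun h => ?_, fun h i j => ?_⟩
    · ext ⟨i, j⟩
      exact (h i j).symm
    · exact (congrArg (fun R : MatrixSpace F n => R (i, j)) h).symm
  · refine ⟨fun h => ?_, fun h i j => ?_⟩
    · ext ⟨i, j⟩
      exact h i j
    · exact congrArg (fun R : MatrixSpace F n => R (i, j)) h

end Entries

/-! ### Automorphisms of the set of projectors -/

section Automorphisms

variable {F : Type} [NormedAddCommGroup F] [InnerProductSpace ℝ F] [Mul F] [One F] [Star F]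
  {n : ℕ}

variable (F n) in
/-- The linear isometries preserving the set of projectors. -/
def projectorGroup : Subgroup (MatrixSpace F n ≃ₗᵢ[ℝ] MatrixSpace F n) where
  carrier := {g | ∀ P, IsProjector (g P) ↔ IsProjector P}
  one_mem' _ := Iff.rfl
  mul_mem' {g h} hg hh P := (hg (h P)).trans (hh P)
  inv_mem' {g} hg P := by
    have h := hg (g.symm P)
    rw [g.apply_symm_apply] at h
    exact h.symm

/-- Squares and traces need to be compared on Hermitian matrices only, where the diagonal entries
are real; the verifications below rely on this. -/
theorem mem_projectorGroup {g : MatrixSpace F n ≃ₗᵢ[ℝ] MatrixSpace F n}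
    (h1 : ∀ P, dagger (g P) = g (dagger P))
    (h2 : ∀ P, dagger P = P → matSq (g P) = g (matSq P))
    (h3 : ∀ P, dagger P = P → ∑ i, g P (i, i) = ∑ i, P (i, i)) : g ∈ projectorGroup F n := by
  intro P
  rw [isProjector_iff, isProjector_iff, h1, g.injective.eq_iff]
  refine and_congr_right fun h => ?_
  rw [h2 P h, h3 P h, g.injective.eq_iff]

/-- The isometry of the projective space induced by a linear isometry. -/
def projectiveIsometry (g : MatrixSpace F n ≃ₗᵢ[ℝ] MatrixSpace F n)
    (hg : g ∈ projectorGroup F n) : ProjectiveSpace F n ≃ᵢ ProjectiveSpace F n where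
  toFun P := ⟨g P.1, (hg P.1).mpr P.2⟩
  invFun P := ⟨g.symm P.1, ((projectorGroup F n).inv_mem hg P.1).mpr P.2⟩
  left_inv P := Subtype.ext (g.symm_apply_apply P.1)
  right_inv P := Subtype.ext (g.apply_symm_apply P.1)
  isometry_toFun := Isometry.of_dist_eq fun P R => g.isometry.dist_eq P.1 R.1

variable [CompositionAlgebra F]

open scoped Matrix Kronecker

theorem conjOrthogonal_mem (O : Matrix (Fin (n + 1)) (Fin (n + 1)) ℝ) (hO : O * Oᵀ = 1) :
    conjOrthogonal (F := F) O hO ∈ projectorGroup F n := by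
  refine mem_projectorGroup (fun P => ?_) (fun P _ => ?_) (fun P _ => ?_)
  · ext ⟨i, j⟩
    simp only [dagger, conjOrthogonal_apply, star_sum_eq, star_smul]
    rw [Finset.sum_comm]
    exact Finset.sum_congr rfl fun a _ => Finset.sum_congr rfl fun b _ => by rw [mul_comm]
  · ext ⟨i, j⟩
    rw [conjOrthogonal_apply]
    refine Eq.trans ?_ (sum_orthogonal_smul hO (fun a b c d => P (a, b) * P (c, d)) i j)
    change ∑ k, conjOrthogonal O hO P (i, k) * conjOrthogonal O hO P (k, j) = _
    refine Finset.sum_congr rfl fun k _ => ?_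
    dsimp only
    rw [conjOrthogonal_apply, conjOrthogonal_apply, sum_mul_left]
    refine Finset.sum_congr rfl fun a _ => ?_
    refine (sum_mul_left _ _ _).trans (Finset.sum_congr rfl fun b _ => ?_)
    refine (mul_sum_right _ _ _).trans (Finset.sum_congr rfl fun c _ => ?_)
    refine (mul_sum_right _ _ _).trans (Finset.sum_congr rfl fun d _ => ?_)
    rw [smul_mul, mul_smul, smul_smul]
  · simp only [conjOrthogonal_apply]
    rw [Finset.sum_comm]
    refine Finset.sum_congr rfl fun a _ => ?_
    rw [Finset.sum_comm]
    simp only [← Finset.sum_smul, sum_orthogonal hO, ite_smul, one_smul, zero_smul]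
    simp

/-- Take `v_i = P_ik / √p` for a column with `p = P_kk > 0`; the rank-one identity then reads `P_ij
= v_i v_j`. -/
theorem IsProjector.exists_realMatrix {P : MatrixSpace F n} (hP : IsProjector P)
    (hr : ∀ p, ∃ r : ℝ, P p = r • (1 : F)) :
    ∃ v : EuclideanSpace ℝ (Fin (n + 1)), ‖v‖ = 1 ∧ P = realMatrix v v := by
  choose r hr using hr
  obtain ⟨k, hk⟩ := hP.exists_diagRe_ge
  set p := diagRe P k with hp
  have hp0 : 0 < p := lt_of_lt_of_le (by positivity) hk
  have hsymm : ∀ i j, r (i, j) = r (j, i) := by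
    intro i j
    apply smul_one_injective (F := F)
    rw [← hr, hP.1, hr, star_smul, star_one]
  refine ⟨WithLp.toLp 2 fun i => r (i, k) / √p, ?_, ?_⟩
  · rw [← sq_eq_sq₀ (norm_nonneg _) zero_le_one, PiLp.norm_sq_eq_of_L2]
    simp only [norm_div, div_pow, Real.norm_eq_abs, sq_abs, Real.sq_sqrt hp0.le]
    rw [← Finset.sum_div, div_eq_iff hp0.ne', one_pow, _root_.one_mul, hp, ← hP.sum_norm_sq]
    refine Finset.sum_congr rfl fun i _ => ?_
    rw [hr, norm_smul, norm_one, _root_.mul_one, Real.norm_eq_abs, sq_abs, hsymm]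
  · ext ⟨i, j⟩
    have h := hP.mul_eq_smul i j k
    rw [hr (i, k), hr (k, j), smul_mul, one_mul, smul_smul, ← hp] at h
    have h' : P (i, j) = p⁻¹ • p • P (i, j) := by
      rw [smul_smul, inv_mul_cancel₀ hp0.ne', one_smul]
    rw [h', ← h, smul_smul]
    simp only [realMatrix]
    congr 1
    rw [hsymm k j, div_mul_div_comm, Real.mul_self_sqrt hp0.le]
    ring

end Automorphisms

end CompositionAlgebra

/-! ### Transitivity on normalized differences of projectors -/

namespace CompositionAlgebra

section Homogeneity

open scoped Matrix

variable {F : Type} [NormedAddCommGroup F] [InnerProductSpace ℝ F] [One F] {n : ℕ}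

theorem inner_realMatrix [Mul F] [Star F] [CompositionAlgebra F] (a b c d : Fin (n + 1) → ℝ) :
    inner ℝ (realMatrix a b : MatrixSpace F n) (realMatrix c d) = (a ⬝ᵥ c) * (b ⬝ᵥ d) := by
  rw [PiLp.inner_apply, Fintype.sum_prod_type, dotProduct, dotProduct, Finset.sum_mul_sum]
  refine Finset.sum_congr rfl fun i _ => Finset.sum_congr rfl fun j _ => ?_
  simp only [realMatrix, inner_smul_left, inner_smul_right, inner_one_one]
  simp only [conj_trivial]
  ring

variable (F n) in
/-- The projector on the first coordinate axis. -/
def basePoint : MatrixSpace F n := realMatrix (Pi.single 0 1) (Pi.single 0 1)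

variable (F n) in
/-- The normalized difference of two orthogonal projectors, up to a real rotation. -/
def baseDirection : MatrixSpace F n :=
  (√2)⁻¹ • (realMatrix (Pi.single 0 1) (Pi.single (Fin.last n) 1)
    + realMatrix (Pi.single (Fin.last n) 1) (Pi.single 0 1))

/-- For unit vectors, `v - w` and `v + w` are orthogonal, so a rotation gives the right-hand side
the shape of a multiple of `baseDirection`. -/
theorem realMatrix_sub (v w : Fin (n + 1) → ℝ) :
    (realMatrix v v - realMatrix w w : MatrixSpace F n)
      = (1 / 2 : ℝ) • (realMatrix (v - w) (v + w) + realMatrix (v + w) (v - w)) := by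
  ext ⟨i, j⟩
  simp only [realMatrix, PiLp.sub_apply, PiLp.smul_apply, PiLp.add_apply, Pi.sub_apply,
    Pi.add_apply, ← sub_smul, ← add_smul, smul_smul]
  congr 1
  ring

theorem realMatrix_smul_smul (r s : ℝ) (v w : Fin (n + 1) → ℝ) :
    (realMatrix (r • v) (s • w) : MatrixSpace F n) = (r * s) • realMatrix v w := by
  ext ⟨i, j⟩
  simp only [realMatrix, PiLp.smul_apply, Pi.smul_apply, smul_smul, smul_eq_mul]
  congr 1
  ring

variable [Mul F] [Star F]

variable (F n) in
/-- Every projector can be made real by an automorphism that fixes the base point. -/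
def HasRealReduction : Prop :=
  ∀ R : MatrixSpace F n, IsProjector R → ∃ g ∈ projectorGroup F n,
    g (basePoint F n) = basePoint F n ∧ ∀ p, ∃ r : ℝ, g R p = r • (1 : F)

variable [CompositionAlgebra F]

theorem norm_baseDirection (hn : 1 ≤ n) : ‖baseDirection F n‖ = 1 := by
  have hne : (0 : Fin (n + 1)) ≠ Fin.last n := by
    intro h
    have := congrArg Fin.val h
    simp at this
    omega
  rw [← sq_eq_sq₀ (norm_nonneg _) zero_le_one, baseDirection, norm_smul, mul_pow,
    norm_add_sq_real, ← real_inner_self_eq_norm_sq (realMatrix _ _),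
    ← real_inner_self_eq_norm_sq (realMatrix _ _), inner_realMatrix, inner_realMatrix,
    inner_realMatrix]
  simp [hne, hne.symm]
  norm_num

theorem exists_map_eq_basePoint (hF : HasRealReduction F n) {P : MatrixSpace F n}
    (hP : IsProjector P) : ∃ g ∈ projectorGroup F n, g P = basePoint F n := by
  obtain ⟨g, hg, -, hreal⟩ := hF P hP
  obtain ⟨v, hv, hgv⟩ := ((hg P).mpr hP).exists_realMatrix hreal
  have hu : Orthonormal ℝ (({0} : Set (Fin (n + 1))).domRestrict fun _ => v) := by
    refine ⟨fun _ => hv, ?_⟩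
    rintro ⟨i, rfl⟩ ⟨j, rfl⟩ hij
    exact absurd rfl hij
  obtain ⟨O, hO, hOv⟩ := exists_orthogonal_mulVec_eq_single hu
  refine ⟨conjOrthogonal O hO * g, mul_mem (conjOrthogonal_mem O hO) hg, ?_⟩
  change conjOrthogonal O hO (g P) = _
  rw [hgv, conjOrthogonal_realMatrix, hOv 0 rfl, basePoint]

/-- After `P` is moved to the base point, `R` is made real without moving the base point. Both are
then `e eᵀ` and `w wᵀ`, and the orthogonal vectors `e - w`, `e + w` are rotated to two coordinate
axes. -/
theorem exists_map_sub_eq_smul (hF : HasRealReduction F n) (hn : 1 ≤ n) {P R : MatrixSpace F n}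
    (hP : IsProjector P) (hR : IsProjector R) :
    ∃ g ∈ projectorGroup F n, g (P - R) = ‖P - R‖ • baseDirection F n := by
  -- The factor need not be computed: `g` is an isometry and `baseDirection` is a unit vector.
  suffices h : ∃ g ∈ projectorGroup F n, ∃ s : ℝ, 0 ≤ s ∧ g (P - R) = s • baseDirection F n by
    obtain ⟨g, hg, s, hs, h⟩ := h
    have : ‖P - R‖ = s := by
      rw [← g.norm_map, h, norm_smul, norm_baseDirection hn, _root_.mul_one, Real.norm_of_nonneg hs]
    exact ⟨g, hg, by rw [this, h]⟩
  obtain ⟨g₁, hg₁, hP₁⟩ := exists_map_eq_basePoint hF hP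
  obtain ⟨g₂, hg₂, hb, hreal⟩ := hF (g₁ R) ((hg₁ R).mpr hR)
  obtain ⟨w, hw, hRw⟩ := ((hg₂ (g₁ R)).mpr ((hg₁ R).mpr hR)).exists_realMatrix hreal
  set e : EuclideanSpace ℝ (Fin (n + 1)) := EuclideanSpace.single 0 1 with he
  have hen : ‖e‖ = 1 := by simp [he]
  obtain ⟨p, hpe⟩ : ∃ p, p = e - w := ⟨_, rfl⟩
  obtain ⟨q, hqe⟩ : ∃ q, q = e + w := ⟨_, rfl⟩
  have hdiff : (g₂ * g₁) (P - R) = (1 / 2 : ℝ) •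
      (realMatrix p q + realMatrix q p : MatrixSpace F n) := by
    rw [map_sub]
    change g₂ (g₁ P) - g₂ (g₁ R) = _
    rw [hP₁, hb, hRw]
    rw [hpe, hqe]
    exact realMatrix_sub _ _
  -- Here `w = ± e`, so the two projectors coincide.
  by_cases h0 : p = 0 ∨ q = 0
  · refine ⟨g₂ * g₁, mul_mem hg₂ hg₁, 0, le_rfl, ?_⟩
    rw [hdiff, zero_smul]
    ext ⟨i, j⟩
    rcases h0 with h | h <;> simp [realMatrix, h]
  push Not at h0
  obtain ⟨hp, hq⟩ := h0
  have hp' := norm_ne_zero_iff.mpr hp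
  have hq' := norm_ne_zero_iff.mpr hq
  have hperp : inner ℝ p q = 0 := by
    rw [hpe, hqe, inner_sub_left, inner_add_right, inner_add_right, real_inner_self_eq_norm_sq,
      real_inner_self_eq_norm_sq, hen, hw, real_inner_comm]
    ring
  have hne : Fin.last n ≠ 0 := by
    intro h
    have := congrArg Fin.val h
    simp at this
    omega
  set u : Fin (n + 1) → EuclideanSpace ℝ (Fin (n + 1)) := fun i =>
    if i = 0 then ‖p‖⁻¹ • p else ‖q‖⁻¹ • q with hu
  have hu0 : u 0 = ‖p‖⁻¹ • p := by simp [hu]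
  have hu1 : u (Fin.last n) = ‖q‖⁻¹ • q := by simp only [hu, if_neg hne]
  have horth : Orthonormal ℝ (({0, Fin.last n} : Set (Fin (n + 1))).domRestrict u) := by
    constructor
    · rintro ⟨i, rfl | rfl⟩
      · change ‖u 0‖ = 1
        rw [hu0, norm_smul, norm_inv, norm_norm, inv_mul_cancel₀ hp']
      · change ‖u (Fin.last n)‖ = 1
        rw [hu1, norm_smul, norm_inv, norm_norm, inv_mul_cancel₀ hq']
    · have h01 : inner ℝ (u 0) (u (Fin.last n)) = 0 := by
        rw [hu0, hu1, inner_smul_left, inner_smul_right, hperp, mul_zero, mul_zero]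
      rintro ⟨i, rfl | rfl⟩ ⟨j, rfl | rfl⟩ hij
      · exact absurd rfl hij
      · exact h01
      · exact (real_inner_comm _ _).trans h01
      · exact absurd rfl hij
  obtain ⟨O, hO, hOu⟩ := exists_orthogonal_mulVec_eq_single horth
  have hO0 : O *ᵥ p = ‖p‖ • Pi.single 0 1 := by
    have h := hOu 0 (Or.inl rfl)
    rw [hu0, WithLp.ofLp_smul, Matrix.mulVec_smul] at h
    rw [← h, smul_smul, mul_inv_cancel₀ hp', one_smul]
  have hO1 : O *ᵥ q = ‖q‖ • Pi.single (Fin.last n) 1 := by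
    have h := hOu (Fin.last n) (Or.inr rfl)
    rw [hu1, WithLp.ofLp_smul, Matrix.mulVec_smul] at h
    rw [← h, smul_smul, mul_inv_cancel₀ hq', one_smul]
  refine ⟨conjOrthogonal O hO * (g₂ * g₁), mul_mem (conjOrthogonal_mem O hO) (mul_mem hg₂ hg₁),
    1 / 2 * (‖p‖ * ‖q‖) * √2, by positivity, ?_⟩
  change conjOrthogonal O hO ((g₂ * g₁) (P - R)) = _
  rw [hdiff, map_smul, map_add, conjOrthogonal_realMatrix, conjOrthogonal_realMatrix, hO0, hO1,
    realMatrix_smul_smul, realMatrix_smul_smul, mul_comm ‖q‖, ← smul_add, smul_smul,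
    baseDirection, smul_smul, mul_inv_cancel_right₀ (by positivity)]

end Homogeneity

/-! ### The theorem for projective spaces with real reduction -/

section Conclusion

variable {F : Type} [NormedAddCommGroup F] [InnerProductSpace ℝ F] [Mul F] [One F] [Star F]
  [CompositionAlgebra F] {n : ℕ}

/-- With `P` moved to the base point, the inner product is a diagonal entry of a projector.
Nonnegativity ensures that squaring the root in `projectiveDist` gives back the inner product. -/
theorem inner_nonneg_of_isProjector (hF : HasRealReduction F n) {P R : MatrixSpace F n}
    (hP : IsProjector P) (hR : IsProjector R) : 0 ≤ (inner ℝ P R : ℝ) := by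
  obtain ⟨g, hg, h⟩ := exists_map_eq_basePoint hF hP
  have hR' : IsProjector (g R) := (hg R).mpr hR
  have h1 : inner ℝ (basePoint F n) (g R) = diagRe (g R) 0 := by
    rw [PiLp.inner_apply, diagRe, Finset.sum_eq_single (0, 0)]
    · simp [basePoint, realMatrix]
    · rintro ⟨i, j⟩ - hij
      have : i ≠ 0 ∨ j ≠ 0 := by
        by_contra! hc
        exact hij (Prod.ext hc.1 hc.2)
      rcases this with hi | hj
      · simp [basePoint, realMatrix, hi]
      · simp [basePoint, realMatrix, hj]
    · simp
  rw [← g.inner_map_map, h, h1]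
  exact hR'.diagRe_nonneg 0

theorem nontrivial_projectiveSpace (hF : HasLineProjectors F n) (hn : 1 ≤ n) :
    Nontrivial (ProjectiveSpace F n) := by
  have hne : Fin.last n ≠ 0 := by
    intro h
    have := congrArg Fin.val h
    simp at this
    omega
  have hproj : ∀ k : Fin (n + 1), IsProjector (lineProjector (Pi.single k (1 : F))) := fun k =>
    isProjector_lineProjector hF ⟨k, by simp⟩
  refine ⟨⟨_, hproj 0⟩, ⟨_, hproj (Fin.last n)⟩, fun h => ?_⟩
  have h1 : ‖lineProjector (n := n) (Pi.single 0 (1 : F)) (0, 0)‖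
      = ‖lineProjector (n := n) (Pi.single (Fin.last n) (1 : F)) (0, 0)‖ :=
    congrArg (fun P : ProjectiveSpace F n => ‖P.1 (0, 0)‖) h
  have h2 : ∀ k, ∑ m, ‖(Pi.single k (1 : F) : Fin (n + 1) → F) m‖ ^ 2 = 1 := by
    intro k
    rw [Finset.sum_eq_single k]
    · simp [norm_one]
    · intro m _ hm
      simp [hm]
    · simp
  simp only [lineProjector, h2, inv_one, one_smul, norm_mul, norm_star, Pi.single_eq_same,
    Pi.single_eq_of_ne hne.symm, norm_one, norm_zero] at h1
  norm_num at h1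

variable [FiniteDimensional ℝ F]

theorem chordalEqSymmDiff_projectiveSpace (hL : HasLineProjectors F n)
    (hF : HasRealReduction F n) (hn : 1 ≤ n) {d : ℕ} (hd : n * Module.finrank ℝ F = d)
    (hd1 : 1 ≤ d) :
    (MetricMeasureData.mk (ProjectiveSpace F n) inferInstance (projectiveDist F n)
      (normalizedVolume (ProjectiveSpace F n) d)).ChordalEqSymmDiff := by
  obtain ⟨hpos, hfin⟩ := hausdorffMeasure_projectiveSpace hL hd
  have : IsProbabilityMeasure (normalizedVolume (ProjectiveSpace F n) d) :=
    isProbabilityMeasure_normalizedVolume hpos hfin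
  have : NullSingletonClass (normalizedVolume (ProjectiveSpace F n) d) :=
    nullSingletonClass_normalizedVolume hd1
  have := nontrivial_projectiveSpace hL hn
  have : SecondCountableTopology (ProjectiveSpace F n) :=
    inferInstanceAs (SecondCountableTopology {P : MatrixSpace F n // IsProjector P})
  have hnorm : ∀ P : ProjectiveSpace F n, ‖P.1‖ = 1 := fun P => IsProjector.norm_eq_one P.2
  have hiso : Isometry (fun P : ProjectiveSpace F n => P.1) := fun _ _ => rfl
  have h0 : ∀ P R : ProjectiveSpace F n, 0 ≤ (inner ℝ P.1 R.1 : ℝ) := fun P R =>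
    inner_nonneg_of_isProjector hF P.2 R.2
  have h1 : ∀ P R : ProjectiveSpace F n, (inner ℝ P.1 R.1 : ℝ) ≤ 1 := fun P R => by
    simpa [hnorm] using real_inner_le_norm P.1 R.1
  have hs0 : ∀ P R : ProjectiveSpace F n, -1 ≤ √(inner ℝ P.1 R.1) := fun P R =>
    (by norm_num : (-1 : ℝ) ≤ 0).trans (Real.sqrt_nonneg _)
  have hs1 : ∀ P R : ProjectiveSpace F n, √(inner ℝ P.1 R.1) ≤ 1 := fun P R =>
    Real.sqrt_le_one.mpr (h1 P R)
  -- From `cos² (θ/2) = ⟨P, R⟩` follow `cos θ = 2 ⟨P, R⟩ - 1` and `‖P - R‖² = 2 - 2 ⟨P, R⟩ = 2 sin²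
  -- (θ/2)`, whence the three constants.
  refine chordalEqSymmDiff_of_homogeneous (ι := fun P : ProjectiveSpace F n => P.1) hiso hnorm
    (baseDirection F n) ?_ (α := 2) (β := -1) (κ := √(1 / 2)) two_pos (by positivity) ?_ ?_ ?_ ?_
  · intro P R
    obtain ⟨g, hg, h⟩ := exists_map_sub_eq_smul hF hn P.2 R.2
    refine ⟨(projectiveIsometry g hg).symm, measurePreserving_normalizedVolume _, fun z => ?_⟩
    change inner ℝ (P.1 - R.1) (g.symm z.1) = ‖P.1 - R.1‖ * inner ℝ (baseDirection F n) z.1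
    rw [← g.inner_map_map, h, g.apply_symm_apply, inner_smul_left]
    rfl
  · intro P
    unfold projectiveDist
    exact continuous_const.mul (Real.continuous_arccos.comp (Real.continuous_sqrt.comp
      (hiso.continuous.inner continuous_const)))
  · intro P R
    have h2 : Real.arccos (√(inner ℝ R.1 P.1)) ≤ Real.pi / 2 :=
      Real.arccos_le_pi_div_two.mpr (Real.sqrt_nonneg _)
    have h3 := Real.arccos_nonneg (√(inner ℝ R.1 P.1))
    constructor <;> unfold projectiveDist <;> linarith
  · intro P R
    rw [projectiveDist, Real.cos_two_mul, Real.cos_arccos (hs0 _ _) (hs1 _ _),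
      Real.sq_sqrt (h0 _ _), real_inner_comm]
    ring
  · intro P R
    rw [projectiveDist, mul_div_cancel_left₀ _ two_ne_zero, Real.sin_arccos, Real.sq_sqrt (h0 _ _),
      ← Real.sqrt_sq (norm_nonneg (P.1 - R.1)), ← Real.sqrt_mul (by norm_num), norm_sub_sq_real,
      hnorm, hnorm]
    congr 1
    ring

end Conclusion

end CompositionAlgebra

/-! ### Line projectors, and real reduction over an associative algebra -/

namespace CompositionAlgebra

section Reduction

variable {F : Type} [NormedAddCommGroup F] [InnerProductSpace ℝ F] [Mul F] [One F] [Star F]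
  [CompositionAlgebra F] {n : ℕ}

theorem hasLineProjectors_of_assoc (h : ∀ x y z : F, x * y * z = x * (y * z)) :
    HasLineProjectors F n := by
  intro z _ i m j
  rw [h, star_mul_mul, mul_smul]

/-- For `n = 2` one needs no associativity: one of three distinct coordinates is equal to `1`. -/
theorem hasLineProjectors_two : HasLineProjectors F 2 := by
  rintro z ⟨k, hk⟩ i m j
  by_cases him : i = m
  · rw [him, self_mul_star, smul_mul, one_mul]
  by_cases hmj : m = j
  · rw [hmj, self_mul_star, mul_smul, mul_one]
  by_cases hij : i = j
  · have hs : z m * star (z i) = star (z i * star (z m)) := by rw [star_mul, star_star]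
    rw [← hij, hs, self_mul_star, self_mul_star, norm_mul, norm_star, smul_smul, mul_pow,
      mul_comm]
  -- Three distinct indices exhaust `Fin 3`, so one of the three coordinates is `1` and the identity
  -- reduces to an alternative law or becomes trivial.
  have hkc : k = i ∨ k = m ∨ k = j := by omega
  rcases hkc with rfl | rfl | rfl
  · rw [hk, one_mul, star_mul_mul, one_mul]
  · rw [hk, star_one, mul_one, one_mul, norm_one, one_pow, one_smul]
  · have h := mul_mul_star (star (z m)) (z i)
    rw [star_star, norm_star] at h
    rw [hk, star_one, mul_one, mul_one, h]

/-- The map `P_ij ↦ (l_ij P_ij) r_ij` with unit coefficients. -/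
def entrywiseIsometry (l r : Fin (n + 1) × Fin (n + 1) → F) (hl : ∀ p, ‖l p‖ = 1)
    (hr : ∀ p, ‖r p‖ = 1) : MatrixSpace F n ≃ₗᵢ[ℝ] MatrixSpace F n :=
  LinearIsometryEquiv.piLpCongrRight 2 fun p =>
    (mulLeftIsometry (l p) (hl p)).trans (mulRightIsometry (r p) (hr p))

theorem entrywiseIsometry_apply (l r : Fin (n + 1) × Fin (n + 1) → F) (hl : ∀ p, ‖l p‖ = 1)
    (hr : ∀ p, ‖r p‖ = 1) (P : MatrixSpace F n) (p : Fin (n + 1) × Fin (n + 1)) :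
    entrywiseIsometry l r hl hr P p = (l p * P p) * r p := rfl

theorem entrywiseIsometry_basePoint (l r : Fin (n + 1) × Fin (n + 1) → F) (hl : ∀ p, ‖l p‖ = 1)
    (hr : ∀ p, ‖r p‖ = 1) (h0 : l (0, 0) * r (0, 0) = 1) :
    entrywiseIsometry l r hl hr (basePoint F n) = basePoint F n := by
  ext ⟨i, j⟩
  rw [entrywiseIsometry_apply]
  simp only [basePoint, realMatrix, mul_smul, smul_mul, mul_one]
  by_cases hi : i = 0
  · by_cases hj : j = 0
    · rw [hi, hj, h0]
    · simp [hj]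
  · simp [hi]

theorem IsProjector.real_of_column {P : MatrixSpace F n} (hP : IsProjector P) {k : Fin (n + 1)}
    (hk : diagRe P k ≠ 0) (h : ∀ i, ∃ r : ℝ, P (i, k) = r • (1 : F)) :
    ∀ p, ∃ r : ℝ, P p = r • (1 : F) := by
  rintro ⟨i, j⟩
  obtain ⟨r, hr⟩ := h i
  obtain ⟨s, hs⟩ := h j
  have h1 := hP.mul_eq_smul i j k
  rw [hP.1 k j, hr, hs, star_smul, star_one, smul_mul, one_mul, smul_smul] at h1
  refine ⟨(diagRe P k)⁻¹ * (r * s), ?_⟩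
  rw [← smul_smul, h1, smul_smul, inv_mul_cancel₀ hk, one_smul]

/-- Conjugate by the diagonal matrix of units `u_i` that make column `k` real. A projector with a
real column and `R_kk ≠ 0` is real by the rank-one identity. -/
theorem hasRealReduction_of_assoc (hassoc : ∀ x y z : F, x * y * z = x * (y * z)) :
    HasRealReduction F n := by
  intro R hR
  obtain ⟨k, hk⟩ := hR.exists_diagRe_ge
  have hp0 : 0 < diagRe R k := lt_of_lt_of_le (by positivity) hk
  choose u hu huR _ using fun i => exists_norm_one_mul (R (i, k))
  set g := entrywiseIsometry (fun p => u p.1) (fun p => star (u p.2)) (fun p => hu p.1)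
    (fun p => (norm_star _).trans (hu p.2)) with hg
  have happ : ∀ (P : MatrixSpace F n) i j, g P (i, j) = (u i * P (i, j)) * star (u j) :=
    fun P i j => rfl
  have hunit : ∀ i, u i * star (u i) = 1 := fun i => by
    rw [self_mul_star, hu, one_pow, one_smul]
  have hgm : g ∈ projectorGroup F n := by
    refine mem_projectorGroup (fun P => ?_) (fun P _ => ?_) (fun P hP => ?_)
    · ext ⟨i, j⟩
      rw [happ]
      simp only [dagger, happ, star_mul, star_star, hassoc]
    · ext ⟨i, j⟩
      rw [happ]
      simp only [matSq, happ, mul_sum_right, sum_mul_left]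
      refine Finset.sum_congr rfl fun m _ => ?_
      have h := star_mul_mul (u m) (P (m, j) * star (u j))
      rw [hu, one_pow, one_smul] at h
      simp only [hassoc, h]
    · refine Finset.sum_congr rfl fun i _ => ?_
      have hd := diag_eq_smul_one (P := P) (fun i j =>
        (congrArg (fun Q : MatrixSpace F n => Q (i, j)) hP).symm) i
      rw [happ, hd, mul_smul, mul_one, smul_mul, hunit]
  -- `R_kk` is already real and positive, so the right factor `star (u k)` leaves column `k`
  -- unchanged.
  have huk : u k = 1 := by
    have h := huR k
    rw [diag_eq_smul_one hR.1, norm_smul, norm_one, _root_.mul_one, mul_smul, mul_one,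
      Real.norm_of_nonneg hp0.le] at h
    exact smul_right_injective F hp0.ne' h
  have hcol : ∀ i, g R (i, k) = ‖R (i, k)‖ • (1 : F) := fun i => by
    rw [happ, huR, huk, star_one, mul_one]
  refine ⟨g, hgm, entrywiseIsometry_basePoint _ _ _ _ (hunit 0), ?_⟩
  refine ((hgm R).mpr hR).real_of_column (k := k) ?_ fun i => ⟨_, hcol i⟩
  rw [diagRe, hcol, inner_smul_right, inner_one_one, diag_eq_smul_one hR.1, norm_smul, norm_one]
  simpa using hp0.ne'

end Reduction

end CompositionAlgebra

/-! ### Automorphisms of the octonionic plane and real reduction -/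

namespace Octonion

open CompositionAlgebra

theorem moufang_left_of_norm {u : Octonion} (hu : ‖u‖ = 1) (x y : Octonion) :
    ((u * x) * u) * (star u * y) = u * (x * y) := by
  rw [moufang_left, mul_star_mul _ hu]

/-- The conjugate of the left identity, applied to `ū`. -/
theorem moufang_right_of_norm {u : Octonion} (hu : ‖u‖ = 1) (x y : Octonion) :
    (x * star u) * ((u * y) * u) = (x * y) * u := by
  have h := congrArg star (moufang_left_of_norm (u := star u) ((CompositionAlgebra.norm_star
    _).trans hu)
    (star y) (star x))
  simp only [CompositionAlgebra.star_mul, CompositionAlgebra.star_star] at h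
  rw [mul_flexible, h]

section Triality

variable (u : Octonion) (hu : ‖u‖ = 1)

/-- Left coefficients of the triality automorphism. -/
def trialityLeft (p : Fin 3 × Fin 3) : Octonion :=
  !![1, u, u; 1, 1, 1; star u, star u, 1] p.1 p.2

/-- Right coefficients of the triality automorphism. -/
def trialityRight (p : Fin 3 × Fin 3) : Octonion :=
  !![1, 1, u; star u, 1, u; star u, 1, 1] p.1 p.2

/-- The automorphism acting on the entries `a = P₀₁`, `b = P₁₂`, `c = P₂₀` of Hermitian matrices by
`a ↦ u a`, `b ↦ b u`, `c ↦ ū c ū`. -/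
def triality : MatrixSpace Octonion 2 ≃ₗᵢ[ℝ] MatrixSpace Octonion 2 :=
  entrywiseIsometry (trialityLeft u) (trialityRight u)
    (by
      rintro ⟨i, j⟩
      have h1 : ‖(1 : Octonion)‖ = 1 := CompositionAlgebra.norm_one
      have h2 : ‖star u‖ = 1 := (CompositionAlgebra.norm_star u).trans hu
      fin_cases i <;> fin_cases j <;> simp [trialityLeft, h1, h2, hu])
    (by
      rintro ⟨i, j⟩
      have h1 : ‖(1 : Octonion)‖ = 1 := CompositionAlgebra.norm_one
      have h2 : ‖star u‖ = 1 := (CompositionAlgebra.norm_star u).trans hu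
      fin_cases i <;> fin_cases j <;> simp [trialityRight, h1, h2, hu])

variable (P : MatrixSpace Octonion 2)

theorem triality_apply (p : Fin 3 × Fin 3) :
    triality u hu P p = (trialityLeft u p * P p) * trialityRight u p := rfl

theorem triality_diag (i : Fin 3) : triality u hu P (i, i) = P (i, i) := by
  rw [triality_apply]
  fin_cases i <;>
    simp [trialityLeft, trialityRight, CompositionAlgebra.one_mul, CompositionAlgebra.mul_one]

theorem triality_zero_one : triality u hu P (0, 1) = u * P (0, 1) :=
  CompositionAlgebra.mul_one _

theorem triality_one_zero : triality u hu P (1, 0) = P (1, 0) * star u :=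
  congrArg (· * star u) (CompositionAlgebra.one_mul _)

theorem triality_one_two : triality u hu P (1, 2) = P (1, 2) * u :=
  congrArg (· * u) (CompositionAlgebra.one_mul _)

theorem triality_two_one : triality u hu P (2, 1) = star u * P (2, 1) :=
  CompositionAlgebra.mul_one _

theorem triality_two_zero : triality u hu P (2, 0) = (star u * P (2, 0)) * star u := rfl

theorem triality_zero_two : triality u hu P (0, 2) = (u * P (0, 2)) * u := rfl

theorem dagger_triality : dagger (triality u hu P) = triality u hu (dagger P) := by
  ext ⟨i, j⟩
  change star (triality u hu P (j, i)) = _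
  fin_cases i <;> fin_cases j <;>
    simp only [Fin.zero_eta, Fin.mk_one, Fin.reduceFinMk, triality_diag, triality_zero_one,
      triality_one_zero, triality_one_two, triality_two_one, triality_two_zero, triality_zero_two,
      CompositionAlgebra.star_mul, CompositionAlgebra.star_star, dagger, mul_flexible]

end Triality

end Octonion

namespace CompositionAlgebra

theorem dagger_matSq {F : Type} [NormedAddCommGroup F] [InnerProductSpace ℝ F] [Mul F] [One F]
    [Star F] [CompositionAlgebra F] {n : ℕ} {P : MatrixSpace F n} (hP : dagger P = P) :
    dagger (matSq P) = matSq P := by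
  ext ⟨i, j⟩
  change star (∑ k, P (j, k) * P (k, i)) = ∑ k, P (i, k) * P (k, j)
  rw [star_sum_eq]
  refine Finset.sum_congr rfl fun k _ => ?_
  have h : ∀ a b, star (P (a, b)) = P (b, a) := fun a b =>
    congrArg (fun Q : MatrixSpace F n => Q (b, a)) hP
  rw [star_mul, h, h]

end CompositionAlgebra

namespace Octonion

open CompositionAlgebra

open scoped Matrix

theorem matSq_apply (P : MatrixSpace Octonion 2) (i j : Fin 3) :
    matSq P (i, j) = P (i, 0) * P (0, j) + P (i, 1) * P (1, j) + P (i, 2) * P (2, j) :=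
  Fin.sum_univ_three fun k => P (i, k) * P (k, j)

theorem conjOrthogonal_apply_three (O : Matrix (Fin 3) (Fin 3) ℝ) (hO : O * Oᵀ = 1)
    (P : MatrixSpace Octonion 2) (i j : Fin 3) :
    conjOrthogonal (n := 2) O hO P (i, j)
      = ((O i 0 * O j 0) • P (0, 0) + (O i 0 * O j 1) • P (0, 1) + (O i 0 * O j 2) • P (0, 2))
      + ((O i 1 * O j 0) • P (1, 0) + (O i 1 * O j 1) • P (1, 1) + (O i 1 * O j 2) • P (1, 2))
      + ((O i 2 * O j 0) • P (2, 0) + (O i 2 * O j 1) • P (2, 1) + (O i 2 * O j 2) • P (2, 2)) := by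
  refine (conjOrthogonal_apply (n := 2) O hO P i j).trans ?_
  refine (Fin.sum_univ_three _).trans ?_
  exact congrArg₂ _ (congrArg₂ _ (Fin.sum_univ_three _) (Fin.sum_univ_three _))
    (Fin.sum_univ_three _)

/-- In each of the entries `(0, 1)`, `(1, 2)`, `(2, 0)` two products contain a real diagonal entry,
and the third transforms by the left, right or middle Moufang identity respectively. The transposed
entries follow by conjugation. The diagonal ones are sums of squared norms, which units preserve. -/
theorem matSq_triality {u : Octonion} (hu : ‖u‖ = 1) {P : MatrixSpace Octonion 2}
    (hP : dagger P = P) : matSq (triality u hu P) = triality u hu (matSq P) := by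
  have hT : dagger (triality u hu P) = triality u hu P := by rw [dagger_triality, hP]
  have hstar : ∀ {Q : MatrixSpace Octonion 2}, dagger Q = Q → ∀ i j, star (Q (i, j)) = Q (j, i) :=
    fun h i j => congrArg (fun Q : MatrixSpace Octonion 2 => Q (j, i)) h
  have hd : ∀ i, P (i, i) = diagRe P i • (1 : Octonion) :=
    diag_eq_smul_one fun i j => (hstar hP j i).symm
  have hdiag : ∀ i, matSq (triality u hu P) (i, i) = triality u hu (matSq P) (i, i) := by
    intro i
    rw [triality_diag]
    change ∑ k, triality u hu P (i, k) * triality u hu P (k, i) = ∑ k, P (i, k) * P (k, i)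
    refine Finset.sum_congr rfl fun k _ => ?_
    rw [← hstar hT i k, ← hstar hP i k, CompositionAlgebra.self_mul_star,
      CompositionAlgebra.self_mul_star]
    congr 2
    rw [triality_apply, CompositionAlgebra.norm_mul, CompositionAlgebra.norm_mul]
    have h1 : ‖(1 : Octonion)‖ = 1 := CompositionAlgebra.norm_one
    have h2 : ‖star u‖ = 1 := (CompositionAlgebra.norm_star u).trans hu
    fin_cases i <;> fin_cases k <;> simp [trialityLeft, trialityRight, h1, h2, hu]
  have h01 : matSq (triality u hu P) (0, 1) = triality u hu (matSq P) (0, 1) := by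
    rw [triality_zero_one]
    rw [matSq_apply, matSq_apply, triality_diag, triality_diag, triality_zero_one,
      triality_zero_two, triality_two_one,
      moufang_left_of_norm hu, hd, hd]
    simp only [CompositionAlgebra.mul_add, CompositionAlgebra.smul_mul,
      CompositionAlgebra.mul_smul, CompositionAlgebra.one_mul, CompositionAlgebra.mul_one]
  have h12 : matSq (triality u hu P) (1, 2) = triality u hu (matSq P) (1, 2) := by
    rw [triality_one_two]
    rw [matSq_apply, matSq_apply, triality_diag, triality_diag, triality_one_two,
      triality_one_zero, triality_zero_two,
      moufang_right_of_norm hu, hd, hd]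
    simp only [CompositionAlgebra.add_mul, CompositionAlgebra.smul_mul,
      CompositionAlgebra.mul_smul, CompositionAlgebra.one_mul, CompositionAlgebra.mul_one]
  have h20 : matSq (triality u hu P) (2, 0) = triality u hu (matSq P) (2, 0) := by
    rw [triality_two_zero]
    rw [matSq_apply, matSq_apply, triality_diag, triality_diag, triality_two_zero,
      triality_two_one, triality_one_zero,
      moufang_middle, hd, hd]
    simp only [CompositionAlgebra.mul_add, CompositionAlgebra.add_mul, CompositionAlgebra.smul_mul,
      CompositionAlgebra.mul_smul, CompositionAlgebra.one_mul, CompositionAlgebra.mul_one]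
  have hsq : dagger (triality u hu (matSq P)) = triality u hu (matSq P) := by
    rw [dagger_triality, dagger_matSq hP]
  have hswap : ∀ i j, matSq (triality u hu P) (i, j) = triality u hu (matSq P) (i, j) →
      matSq (triality u hu P) (j, i) = triality u hu (matSq P) (j, i) := fun i j h => by
    rw [← hstar (dagger_matSq hT) i j, h, hstar hsq]
  ext ⟨i, j⟩
  fin_cases i <;> fin_cases j
  · exact hdiag 0
  · exact h01
  · exact hswap _ _ h20
  · exact hswap _ _ h01
  · exact hdiag 1
  · exact h12
  · exact h20
  · exact hswap _ _ h12
  · exact hdiag 2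

theorem triality_mem {u : Octonion} (hu : ‖u‖ = 1) : triality u hu ∈ projectorGroup Octonion 2 :=
  mem_projectorGroup (fun P => dagger_triality u hu P) (fun _ hP => matSq_triality hu hP)
    (fun P _ => Finset.sum_congr rfl fun i _ => triality_diag u hu P i)

theorem triality_basePoint {u : Octonion} (hu : ‖u‖ = 1) :
    triality u hu (basePoint Octonion 2) = basePoint Octonion 2 :=
  entrywiseIsometry_basePoint _ _ _ _ (CompositionAlgebra.one_mul _)

theorem conjOrthogonal_basePoint {O : Matrix (Fin 3) (Fin 3) ℝ} (hO : O * Oᵀ = 1)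
    (h : O *ᵥ Pi.single 0 1 = Pi.single 0 1) :
    conjOrthogonal O hO (basePoint Octonion 2) = basePoint Octonion 2 := by
  rw [basePoint]
  refine (conjOrthogonal_realMatrix (n := 2) O hO _ _).trans ?_
  rw [h]

/-- Up to conjugation, `R (0, 1)` is the only off-diagonal entry left, and `triality` multiplies it
by a unit of choice. -/
theorem exists_real_of_column_two_eq_zero {R : MatrixSpace Octonion 2} (hR : IsProjector R)
    (h02 : R (0, 2) = 0) (h12 : R (1, 2) = 0) :
    ∃ g ∈ projectorGroup Octonion 2, g (basePoint Octonion 2) = basePoint Octonion 2 ∧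
      ∀ p, ∃ r : ℝ, g R p = r • (1 : Octonion) := by
  obtain ⟨u, hu, hur, -⟩ := exists_norm_one_mul (R (0, 1))
  have hm := triality_mem hu
  refine ⟨triality u hu, hm, triality_basePoint hu, ?_⟩
  have hS : IsProjector (triality u hu R) := (hm R).mpr hR
  have hz : ∀ x : Octonion, (0 : Octonion) * x = 0 := fun x => mul_eq_zero_iff.mpr (Or.inl rfl)
  have hz' : ∀ x : Octonion, x * (0 : Octonion) = 0 := fun x => mul_eq_zero_iff.mpr (Or.inr rfl)
  have k01 : triality u hu R (0, 1) = ‖R (0, 1)‖ • (1 : Octonion) := by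
    rw [triality_zero_one, hur]
  have k02 : triality u hu R (0, 2) = (0 : ℝ) • (1 : Octonion) := by
    rw [triality_zero_two, h02, hz', hz, zero_smul]
  have k12 : triality u hu R (1, 2) = (0 : ℝ) • (1 : Octonion) := by
    rw [triality_one_two, h12, hz, zero_smul]
  have hsymm : ∀ i j, (∃ r : ℝ, triality u hu R (i, j) = r • (1 : Octonion)) →
      ∃ r : ℝ, triality u hu R (j, i) = r • (1 : Octonion) := by
    rintro i j ⟨r, hr⟩
    exact ⟨r, by rw [hS.1, hr, CompositionAlgebra.star_smul, CompositionAlgebra.star_one]⟩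
  rintro ⟨i, j⟩
  fin_cases i <;> fin_cases j
  · exact ⟨_, diag_eq_smul_one hS.1 0⟩
  · exact ⟨_, k01⟩
  · exact ⟨_, k02⟩
  · exact hsymm _ _ ⟨_, k01⟩
  · exact ⟨_, diag_eq_smul_one hS.1 1⟩
  · exact ⟨_, k12⟩
  · exact hsymm _ _ ⟨_, k02⟩
  · exact hsymm _ _ ⟨_, k12⟩
  · exact ⟨_, diag_eq_smul_one hS.1 2⟩

/-- Exchange of the last two coordinates. -/
def swapMatrix : Matrix (Fin 3) (Fin 3) ℝ := !![1, 0, 0; 0, 0, 1; 0, 1, 0]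

/-- Rotation by the angle `t` in the plane of the last two coordinates. -/
def rotationMatrix (t : ℝ) : Matrix (Fin 3) (Fin 3) ℝ :=
  !![1, 0, 0; 0, Real.cos t, -Real.sin t; 0, Real.sin t, Real.cos t]

theorem swapMatrix_mul_transpose : swapMatrix * swapMatrixᵀ = 1 := by
  ext i j
  fin_cases i <;> fin_cases j <;> simp [swapMatrix, Matrix.mul_apply, Fin.sum_univ_three]

theorem rotationMatrix_mul_transpose (t : ℝ) : rotationMatrix t * (rotationMatrix t)ᵀ = 1 := by
  have h := Real.sin_sq_add_cos_sq t
  ext i j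
  fin_cases i <;> fin_cases j <;>
    simp [rotationMatrix, Matrix.mul_apply, Fin.sum_univ_three] <;> linarith

/-- The expression is the off-diagonal entry of a rotated symmetric `2 × 2` matrix with diagonal `a,
c` and off-diagonal entry `b`. It passes from `b` at `t = 0` to `-b` at `t = π/2`, hence vanishes in
between. -/
theorem exists_rotation_angle (a b c : ℝ) :
    ∃ t : ℝ, (Real.cos t ^ 2 - Real.sin t ^ 2) * b + Real.cos t * Real.sin t * (a - c) = 0 := by
  set f : ℝ → ℝ := fun t =>
    (Real.cos t ^ 2 - Real.sin t ^ 2) * b + Real.cos t * Real.sin t * (a - c) with hf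
  have hc : Continuous f := by fun_prop
  have h0 : f 0 = b := by simp [hf]
  have h1 : f (Real.pi / 2) = -b := by simp [hf]
  rcases le_total 0 b with hb | hb
  · exact mem_range_of_exists_le_of_exists_ge hc ⟨Real.pi / 2, by linarith⟩ ⟨0, by linarith⟩
  · exact mem_range_of_exists_le_of_exists_ge hc ⟨0, by linarith⟩ ⟨Real.pi / 2, by linarith⟩

/-- `triality` makes the entry `(1, 2)` real, and the resulting real lower block is diagonalized by
a rotation that fixes the first axis. -/
theorem exists_map_one_two_eq_zero {R : MatrixSpace Octonion 2} (hR : IsProjector R) :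
    ∃ g ∈ projectorGroup Octonion 2, g (basePoint Octonion 2) = basePoint Octonion 2 ∧
      g R (1, 2) = 0 := by
  obtain ⟨u, hu, -, hur⟩ := exists_norm_one_mul (R (1, 2))
  have hm := triality_mem hu
  set S := triality u hu R with hS
  have hSp : IsProjector S := (hm R).mpr hR
  have hS12 : S (1, 2) = ‖R (1, 2)‖ • (1 : Octonion) := by rw [hS, triality_one_two, hur]
  have hS21 : S (2, 1) = ‖R (1, 2)‖ • (1 : Octonion) := by
    rw [hSp.1, hS12, CompositionAlgebra.star_smul, CompositionAlgebra.star_one]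
  obtain ⟨t, ht⟩ := exists_rotation_angle (diagRe S 1) ‖R (1, 2)‖ (diagRe S 2)
  set O := rotationMatrix t with hOdef
  have hO : O * Oᵀ = 1 := rotationMatrix_mul_transpose t
  have hOb : O *ᵥ Pi.single 0 1 = Pi.single 0 1 := by
    ext i
    fin_cases i <;> simp [hOdef, rotationMatrix]
  have hOm := conjOrthogonal_mem (F := Octonion) (n := 2) O hO
  have hT12 : conjOrthogonal (n := 2) O hO S (1, 2) = 0 := by
    refine (conjOrthogonal_apply_three O hO S 1 2).trans ?_
    simp only [hS12, hS21, diag_eq_smul_one hSp.1, hOdef, rotationMatrix]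
    simp only [Matrix.of_apply, Matrix.cons_val, zero_mul, mul_zero, zero_smul, zero_add,
      smul_smul, ← add_smul]
    rw [← zero_smul ℝ (1 : Octonion)]
    congr 1
    linarith
  exact ⟨conjOrthogonal (F := Octonion) (n := 2) O hO * triality u hu, mul_mem hOm hm,
    (congrArg (conjOrthogonal (F := Octonion) (n := 2) O hO) (triality_basePoint hu)).trans
      (conjOrthogonal_basePoint hO hOb), hT12⟩

theorem exists_map_column_two_eq_zero {T : MatrixSpace Octonion 2} (hT : IsProjector T)
    (h12 : T (1, 2) = 0) :
    ∃ g ∈ projectorGroup Octonion 2, g (basePoint Octonion 2) = basePoint Octonion 2 ∧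
      g T (0, 2) = 0 ∧ g T (1, 2) = 0 := by
  -- The rank-one identity gives `T₁₀ T₀₂ = T₀₀ T₁₂ = 0`, and there are no zero divisors. If `T₁₀ =
  -- 0`, exchanging the last two coordinates brings the zeros `T₀₁`, `T₂₁` into the last column.
  have hzero : T (1, 0) = 0 ∨ T (0, 2) = 0 := by
    rw [← mul_eq_zero_iff, hT.mul_eq_smul, h12, smul_zero]
  rcases hzero with h | h
  · have hwb : swapMatrix *ᵥ Pi.single 0 1 = Pi.single 0 1 := by
      ext i
      fin_cases i <;> simp [swapMatrix]
    have hs0 : star (0 : Octonion) = 0 := map_zero (starLinear Octonion)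
    have h01 : T (0, 1) = 0 := by rw [hT.1, h, hs0]
    have h21 : T (2, 1) = 0 := by rw [hT.1, h12, hs0]
    refine ⟨conjOrthogonal (n := 2) swapMatrix swapMatrix_mul_transpose,
      conjOrthogonal_mem (F := Octonion) (n := 2) swapMatrix swapMatrix_mul_transpose,
      conjOrthogonal_basePoint _ hwb, ?_, ?_⟩
    · refine (conjOrthogonal_apply_three _ _ T 0 2).trans ?_
      simp [swapMatrix, h01]
    · refine (conjOrthogonal_apply_three _ _ T 1 2).trans ?_
      simp [swapMatrix, h21]
  · exact ⟨1, one_mem _, rfl, h, h12⟩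

theorem hasRealReduction : HasRealReduction Octonion 2 := by
  intro R hR
  obtain ⟨g, hg, hgb, h⟩ := exists_map_one_two_eq_zero hR
  have hT := (hg R).mpr hR
  obtain ⟨k, hk, hkb, h02, h12⟩ := exists_map_column_two_eq_zero hT h
  obtain ⟨l, hl, hlb, hreal⟩ :=
    exists_real_of_column_two_eq_zero ((hk (g R)).mpr hT) h02 h12
  refine ⟨l * (k * g), mul_mem hl (mul_mem hk hg), ?_, hreal⟩
  change l (k (g _)) = _
  rw [hgb, hkb, hlb]

end Octonion

/-! ### Assembly of the five cases -/

open CompositionAlgebra in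
theorem chordalEqSymmDiff_twoPointSpace (s : SpaceLabel) : (twoPointSpace s).ChordalEqSymmDiff := by
  cases s with
  | sphere d hd => exact chordalEqSymmDiff_sphere d hd
  | realProjective n hn =>
    exact chordalEqSymmDiff_projectiveSpace (hasLineProjectors_of_assoc mul_assoc)
      (hasRealReduction_of_assoc mul_assoc) (by omega)
      (by rw [Module.finrank_self, _root_.mul_one]) (by omega)
  | complexProjective n hn =>
    exact chordalEqSymmDiff_projectiveSpace (hasLineProjectors_of_assoc mul_assoc)
      (hasRealReduction_of_assoc mul_assoc) (by omega)
      (by rw [Complex.finrank_real_complex, mul_comm]) (by omega)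
  | quaternionicProjective n hn =>
    exact chordalEqSymmDiff_projectiveSpace (hasLineProjectors_of_assoc mul_assoc)
      (hasRealReduction_of_assoc mul_assoc) (by omega)
      (by rw [Quaternion.finrank_eq_four, mul_comm]) (by omega)
  | octonionicPlane =>
    exact chordalEqSymmDiff_projectiveSpace hasLineProjectors_two Octonion.hasRealReduction
      (by norm_num) (by rw [Octonion.finrank_eq]) (by norm_num)

end

theorem theorem2p1 (s : SpaceLabel) :
    ∃ γ : ℝ,
      (∀ x₁ x₂ : (twoPointSpace s).carrier,
        (twoPointSpace s).chordalMetric x₁ x₂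
          = γ * (twoPointSpace s).symmDiffMetric Real.sin x₁ x₂) ∧
      γ = (twoPointSpace s).average (twoPointSpace s).chordalMetric
          / (twoPointSpace s).average ((twoPointSpace s).symmDiffMetric Real.sin) ∧
      γ = (twoPointSpace s).diam (twoPointSpace s).chordalMetric
          / (twoPointSpace s).diam ((twoPointSpace s).symmDiffMetric Real.sin) :=
  chordalEqSymmDiff_twoPointSpace s
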